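/- Let $\Omega\subset\mathbb R^2$ be a bounded domain (non-empty, open, connected) with Lipschitz boundary, and let $\kappa,Q\in\mathbb R$. For $m=(m',m_3)\in H^1(\Omega;\mathbb S^2)$, i.e. $m\in H^1(\Omega;\mathbb R^3)$ with $|m|=1$ a.e. in $\Omega$, let $$\mathcal E(m)=\int_\Omega\Big(|\nabla m|^2-2\kappa\, m'\cdot\nabla m_3+(Q-1)|m'|^2\Big)\,dx,\qquad \mathcal N(m)=\frac1{4\pi}\int_\Omega m\cdot(\partial_1 m\times\partial_2 m)\,dx,$$ and for $d\in\mathbb Z$ let $$\mathcal A_d=\big\{m\in H^1(\Omega;\mathbb S^2): m=-e_3\text{ on }\partial\Omega,\ \mathcal N(m)=d\big\},$$ where the boundary condition means $m+e_3\in H^1_0(\Omega;\mathbb R^3)$. Then for every integer $d\ge 0$ $$\inf_{\mathcal A_{d+1}}\mathcal E\le\inf_{\mathcal A_d}\mathcal E+8\pi,$$ the infima being taken in $[-\infty,+\infty]$ (with $\inf\emptyset=+\infty$). -/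

import Mathlib

open MeasureTheory
open scoped NNReal ENNReal Matrix ContDiff

noncomputable section

namespace ConfinedSkyrmion

/-- The plane `ℝ²` with its Euclidean structure. -/
abbrev Plane : Type := EuclideanSpace ℝ (Fin 2)

/-- The target space `ℝ³` with its Euclidean structure. -/
abbrev Space : Type := EuclideanSpace ℝ (Fin 3)

/-- The third standard unit vector of `ℝ³`. -/
def e3 : Space := EuclideanSpace.single 2 1

/-- `Ω` has Lipschitz boundary: near each boundary point and in suitable Cartesian coordinates
(given by a Euclidean isometry `Φ` of the plane), `Ω` is the region strictly above the graph of a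
Lipschitz function `γ`. -/
def HasLipschitzBoundary (Ω : Set Plane) : Prop :=
  ∀ x ∈ frontier Ω, ∃ (Φ : Plane ≃ᵃⁱ[ℝ] Plane) (γ : ℝ → ℝ) (K : ℝ≥0) (r : ℝ),
    LipschitzWith K γ ∧ 0 < r ∧ ∀ y ∈ Metric.ball x r, (y ∈ Ω ↔ γ (Φ y 0) < Φ y 1)

/-- A bounded domain (non-empty, open, connected, bounded set) with Lipschitz boundary. -/
structure IsBoundedLipschitzDomain (Ω : Set Plane) : Prop where
  isOpen : IsOpen Ω
  isConnected : IsConnected Ω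
  isBounded : Bornology.IsBounded Ω
  lipschitz : HasLipschitzBoundary Ω

variable {F : Type*} [NormedAddCommGroup F] [NormedSpace ℝ F]

/-- The classical partial derivative `∂ᵢ φ` of a function on the plane. -/
def classicalPartial (i : Fin 2) (φ : Plane → F) (x : Plane) : F :=
  fderiv ℝ φ x (EuclideanSpace.single i 1)

/-- `φ` is a smooth function with compact support contained in `Ω`. -/
def IsTestFunction (Ω : Set Plane) (φ : Plane → F) : Prop :=
  ContDiff ℝ ∞ φ ∧ HasCompactSupport φ ∧ tsupport φ ⊆ Ω

/-- `g` is a weak (distributional) partial derivative `∂ᵢ f` of `f` in the open set `Ω`. Only the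
values of `f` and `g` on `Ω`, up to null sets, matter. -/
def IsWeakPartial (Ω : Set Plane) (i : Fin 2) (f g : Plane → F) : Prop :=
  LocallyIntegrableOn f Ω ∧ LocallyIntegrableOn g Ω ∧
    ∀ φ : Plane → ℝ, IsTestFunction Ω φ →
      ∫ x in Ω, classicalPartial i φ x • f x = - ∫ x in Ω, φ x • g x

open Classical in
/-- The weak partial derivative `∂ᵢ f` of `f` in the open set `Ω` (a representative of it; it is
unique up to null subsets of `Ω`), with the convention that it is `0` if `f` has none. -/
def weakPartial (Ω : Set Plane) (i : Fin 2) (f : Plane → F) : Plane → F :=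
  if h : ∃ g, IsWeakPartial Ω i f g then h.choose else 0

/-- `f` belongs to the Sobolev space `H¹(Ω; F)`. -/
def MemH1 (Ω : Set Plane) (f : Plane → F) : Prop :=
  MemLp f 2 (volume.restrict Ω) ∧
    ∀ i : Fin 2, ∃ g : Plane → F, IsWeakPartial Ω i f g ∧ MemLp g 2 (volume.restrict Ω)

/-- `f` belongs to `H¹₀(Ω; F)`, the closure of the test functions `C_c^∞(Ω; F)` in `H¹(Ω; F)`. -/
def MemH10 (Ω : Set Plane) (f : Plane → F) : Prop :=
  MemH1 Ω f ∧
    ∀ ε : ℝ≥0∞, 0 < ε → ∃ φ : Plane → F, IsTestFunction Ω φ ∧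
      eLpNorm (f - φ) 2 (volume.restrict Ω) < ε ∧
      ∀ i : Fin 2,
        eLpNorm (weakPartial Ω i f - classicalPartial i φ) 2 (volume.restrict Ω) < ε

/-- The energy
`𝓔(m) = ∫_Ω ( |∇m|² - 2 κ m' ⋅ ∇m₃ + (Q - 1) |m'|² ) dx`, where `m = (m', m₃)`. The coordinates
`m₁, m₂, m₃` are indexed by `0, 1, 2`. -/
def energy (Ω : Set Plane) (κ Q : ℝ) (m : Plane → Space) : ℝ :=
  ∫ x in Ω,
    ((‖weakPartial Ω 0 m x‖ ^ 2 + ‖weakPartial Ω 1 m x‖ ^ 2)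
      - 2 * κ * (m x 0 * weakPartial Ω 0 m x 2 + m x 1 * weakPartial Ω 1 m x 2)
      + (Q - 1) * (m x 0 ^ 2 + m x 1 ^ 2))

/-- The topological degree `𝓝(m) = (1 / 4π) ∫_Ω m ⋅ (∂₁m × ∂₂m) dx`. (For `m` equal to `-e₃` on
the boundary, the extension of `m` by the constant `-e₃` does not contribute outside `Ω`.) -/
def degree (Ω : Set Plane) (m : Plane → Space) : ℝ :=
  1 / (4 * Real.pi) *
    ∫ x in Ω, (m x).ofLp ⬝ᵥ ((weakPartial Ω 0 m x).ofLp ⨯₃ (weakPartial Ω 1 m x).ofLp)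

/-- The admissible class `𝓐_d` of all `m ∈ H¹(Ω; 𝕊²)` with `m = -e₃` on `∂Ω` (that is,
`m + e₃ ∈ H¹₀(Ω; ℝ³)`) and with degree `d`. -/
def admissible (Ω : Set Plane) (d : ℤ) : Set (Plane → Space) :=
  {m | MemH1 Ω m ∧ (∀ᵐ x ∂(volume.restrict Ω), ‖m x‖ = 1) ∧
    MemH10 Ω (fun x => m x + e3) ∧ degree Ω m = (d : ℝ)}

/-- The infimum of the energy over `𝓐_d`, as an extended real number (so that it is a genuine
infimum whether or not the class is empty or the energy is bounded below). -/
def infEnergy (Ω : Set Plane) (κ Q : ℝ) (d : ℤ) : EReal :=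
  ⨅ m ∈ admissible Ω d, (energy Ω κ Q m : EReal)

end ConfinedSkyrmion

end

/-!
The infimum inequality follows once every `m` of degree `d` can be modified, for every `ε > 0`, to an
admissible map of degree `d + 1` whose energy is larger by at most `8π + ε`
(`exists_mem_admissible_add_one`). The modification inserts a skyrmion of degree one in a small ball
on which `m` has first been made constant.

*Freeing a ball.* Extend `m` by `-e₃` to the plane. At a boundary point, let `v` be the unit vector
along the axis of the graph, pointing into `Ω`. The map `ψ x = x - η(x) v`, with a small nonnegative
bump `η`, is a diffeomorphism of the plane which is `δ`-close to the identity in `C¹`, with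
`ψ⁻¹(Ω) ⊆ Ω` because `Ω` lies above a graph, and there is a ball in `Ω` that `ψ` maps out of `Ω`
(`IsBoundedLipschitzDomain.exists_shift`). Hence `m ∘ ψ` has the boundary values `-e₃`, equals `-e₃`
on that ball, has the degree of `m` by the change of variables formula, and its energy differs from
that of `m` by `O(δ)` (`integral_energyDensity_shift_le`). No regularity of `m` beyond `H¹` is used:
since `m + e₃ ∈ H¹₀`, the chain rule follows by approximation with test functions
(`IsH10Pair.comp_shift`).

*The skyrmion.* Let `s = |y|²` and let `c` be a smooth function of `s` with `c(0) ≠ 0` that vanishes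
for large `s`. The inverse stereographic projection of `c(s) y / s` is a smooth map to the sphere,
equal to `-e₃` for large `s`, with third component `h = (c² - s) / (c² + s)`. Its degree density is
`-2 h'(s)`, with integral `4π` over the plane, and its Dirichlet density exceeds twice the degree
density by `16 c'² s² / (c² + s)²` (`IsBubbleProfile.dirichlet_bubble`). For `c = μ χ` with a fixed
cutoff `χ` and small `μ` the excess is negligible, so the Dirichlet energy is close to `8π`; in a
small ball the remaining terms of the energy are negligible by Young's inequality.
-/

namespace ConfinedSkyrmion

open Filter Topology

/-! ### Weak derivatives and `H¹₀` -/

section Sobolev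

variable {F : Type*} [NormedAddCommGroup F] [NormedSpace ℝ F] {Ω : Set Plane}

namespace IsTestFunction

variable {φ : Plane → F}

lemma eq_zero (hφ : IsTestFunction Ω φ) {x : Plane} (hx : x ∉ Ω) : φ x = 0 :=
  image_eq_zero_of_notMem_tsupport fun h => hx (hφ.2.2 h)

lemma contDiff_classicalPartial (hφ : IsTestFunction Ω φ) (i : Fin 2) :
    ContDiff ℝ ∞ (classicalPartial i φ) :=
  (hφ.1.fderiv_right (m := ∞) (by simp)).clm_apply contDiff_const

lemma tsupport_classicalPartial_subset (φ : Plane → F) (i : Fin 2) :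
    tsupport (classicalPartial i φ) ⊆ tsupport φ :=
  tsupport_fderiv_apply_subset ℝ _

lemma classicalPartial (hφ : IsTestFunction Ω φ) (i : Fin 2) :
    IsTestFunction Ω (classicalPartial i φ) :=
  ⟨hφ.contDiff_classicalPartial i,
    hφ.2.1.of_isClosed_subset (isClosed_tsupport _) (tsupport_classicalPartial_subset φ i),
    (tsupport_classicalPartial_subset φ i).trans hφ.2.2⟩

lemma memLp (hφ : IsTestFunction Ω φ) : MemLp φ 2 volume :=
  hφ.1.continuous.memLp_of_hasCompactSupport hφ.2.1

lemma add {χ : Plane → F} (hφ : IsTestFunction Ω φ) (hχ : IsTestFunction Ω χ) :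
    IsTestFunction Ω (φ + χ) :=
  ⟨hφ.1.add hχ.1, hφ.2.1.add hχ.2.1,
    (tsupport_add φ χ).trans (Set.union_subset hφ.2.2 hχ.2.2)⟩

lemma differentiable (hφ : IsTestFunction Ω φ) : Differentiable ℝ φ :=
  hφ.1.differentiable (by simp)

lemma integral_eq (hφ : IsTestFunction Ω φ) {χ : Plane → ℝ} (hχ : IsTestFunction Set.univ χ)
    (i : Fin 2) :
    ∫ x, ConfinedSkyrmion.classicalPartial i χ x • φ x =
      - ∫ x, χ x • ConfinedSkyrmion.classicalPartial i φ x := by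
  have key : ∀ {a : Plane → ℝ} {b : Plane → F}, IsTestFunction Set.univ a →
      IsTestFunction Ω b → Integrable fun x => a x • b x := fun ha hb =>
    memLp_one_iff_integrable.1 (hb.memLp.smul ha.memLp)
  have := integral_smul_fderiv_eq_neg_fderiv_smul_of_integrable (μ := volume) (f := χ) (g := φ)
    (v := EuclideanSpace.single i 1) (key (hχ.classicalPartial i) hφ)
    (key hχ (hφ.classicalPartial i)) (key hχ hφ) (fun x _ => hχ.differentiable x)
    (fun x _ => hφ.differentiable x)
  simp only [ConfinedSkyrmion.classicalPartial]
  rw [this, neg_neg]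

end IsTestFunction

lemma integrableOn_smul_of_locallyIntegrableOn {φ : Plane → ℝ} (hφ : IsTestFunction Ω φ)
    {g : Plane → F} (hg : LocallyIntegrableOn g Ω) :
    Integrable (fun x => φ x • g x) (volume.restrict Ω) := by
  have h1 : IntegrableOn (fun x => φ x • g x) (tsupport φ) :=
    (hg.integrableOn_compact_subset hφ.2.2 hφ.2.1).continuousOn_smul
      hφ.1.continuous.continuousOn hφ.2.1
  have h2 : Integrable (fun x => φ x • g x) volume := by
    refine (integrableOn_iff_integrable_of_support_subset ?_).1 h1
    intro x hx
    refine subset_tsupport φ ?_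
    intro h
    exact hx (by simp [h])
  exact h2.integrableOn

/-- Weak partial derivatives are unique up to null sets. -/
lemma IsWeakPartial.ae_eq [CompleteSpace F] (hΩ : IsOpen Ω) {i : Fin 2} {f g g' : Plane → F}
    (h : IsWeakPartial Ω i f g) (h' : IsWeakPartial Ω i f g') :
    g =ᵐ[volume.restrict Ω] g' := by
  have h0 : ∀ᵐ x ∂volume, x ∈ Ω → (g - g') x = 0 := by
    refine hΩ.ae_eq_zero_of_integral_contDiff_smul_eq_zero (h.2.1.sub h'.2.1) ?_
    intro φ h1 h2 h3
    have hφ : IsTestFunction Ω φ := ⟨h1, h2, h3⟩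
    rw [← setIntegral_eq_integral_of_forall_compl_eq_zero (s := Ω)
      (fun x hx => by simp [hφ.eq_zero hx])]
    simp only [Pi.sub_apply, smul_sub]
    rw [integral_sub (integrableOn_smul_of_locallyIntegrableOn hφ h.2.1)
      (integrableOn_smul_of_locallyIntegrableOn hφ h'.2.1), sub_eq_zero]
    exact neg_injective ((h.2.2 φ hφ).symm.trans (h'.2.2 φ hφ))
  rw [EventuallyEq, ae_restrict_iff' hΩ.measurableSet]
  filter_upwards [h0] with x hx hxΩ
  exact sub_eq_zero.1 (hx hxΩ)

lemma isWeakPartial_weakPartial {i : Fin 2} {f g : Plane → F} (h : IsWeakPartial Ω i f g) :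
    IsWeakPartial Ω i f (weakPartial Ω i f) := by
  have hex : ∃ g, IsWeakPartial Ω i f g := ⟨g, h⟩
  rw [weakPartial, dif_pos hex]
  exact hex.choose_spec

lemma IsWeakPartial.weakPartial_ae_eq [CompleteSpace F] (hΩ : IsOpen Ω) {i : Fin 2}
    {f g : Plane → F} (h : IsWeakPartial Ω i f g) :
    weakPartial Ω i f =ᵐ[volume.restrict Ω] g :=
  (isWeakPartial_weakPartial h).ae_eq hΩ h

lemma integral_classicalPartial_smul_const {φ : Plane → ℝ} (hφ : IsTestFunction Ω φ) (i : Fin 2)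
    (c : F) : ∫ x in Ω, classicalPartial i φ x • c = 0 := by
  rw [setIntegral_eq_integral_of_forall_compl_eq_zero
      (fun x hx => by simp [(hφ.classicalPartial i).eq_zero hx])]
  have hi : ∀ {χ : Plane → ℝ}, IsTestFunction Ω χ → Integrable fun x => χ x • c := fun hχ =>
    (hχ.1.continuous.integrable_of_hasCompactSupport hχ.2.1).smul_const c
  have := integral_smul_fderiv_eq_neg_fderiv_smul_of_integrable (μ := volume) (f := φ)
    (g := fun _ : Plane => c) (v := EuclideanSpace.single i 1) (hi (hφ.classicalPartial i))
    (by simp) (hi hφ) (fun x _ => hφ.differentiable x)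
    (fun x _ => differentiableAt_const _)
  simpa [classicalPartial] using this.symm

/-- Adding a constant does not change weak partial derivatives. -/
lemma IsWeakPartial.add_const {i : Fin 2} {f g : Plane → F} (h : IsWeakPartial Ω i f g) (c : F) :
    IsWeakPartial Ω i (fun x => f x + c) g := by
  have hc : LocallyIntegrableOn (fun _ : Plane => c) Ω :=
    (locallyIntegrable_const c).locallyIntegrableOn Ω
  refine ⟨h.1.add hc, h.2.1, fun φ hφ => ?_⟩
  simp only [smul_add]
  rw [integral_add (integrableOn_smul_of_locallyIntegrableOn (hφ.classicalPartial i) h.1)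
    (integrableOn_smul_of_locallyIntegrableOn (hφ.classicalPartial i) hc),
    integral_classicalPartial_smul_const hφ, add_zero, h.2.2 φ hφ]

/-- The pair `(f, g)` represents an element of `H¹₀(Ω; F)` and its gradient, both extended by `0`
to the whole plane: `f` and `g i` are square integrable, vanish outside `Ω`, and are the `L²` limits
of test functions in `Ω` and of their partial derivatives. -/
structure IsH10Pair (Ω : Set Plane) (f : Plane → F) (g : Fin 2 → Plane → F) : Prop where
  memLp : MemLp f 2 volume
  memLp_partial : ∀ i, MemLp (g i) 2 volume
  eq_zero : ∀ x ∉ Ω, f x = 0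
  partial_eq_zero : ∀ i, ∀ x ∉ Ω, g i x = 0
  approx : ∀ ε : ℝ≥0∞, 0 < ε → ∃ φ : Plane → F, IsTestFunction Ω φ ∧
    eLpNorm (f - φ) 2 volume < ε ∧ ∀ i, eLpNorm (g i - classicalPartial i φ) 2 volume < ε

lemma enorm_integral_smul_le {u : Plane → ℝ} {h : Plane → F} (hu : MemLp u 2 volume)
    (hh : MemLp h 2 volume) :
    ‖∫ x, u x • h x‖ₑ ≤ eLpNorm u 2 volume * eLpNorm h 2 volume := by
  calc ‖∫ x, u x • h x‖ₑ ≤ ∫⁻ x, ‖u x • h x‖ₑ := enorm_integral_le_lintegral_enorm _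
    _ = eLpNorm (u • h) 1 volume := by rw [eLpNorm_one_eq_lintegral_enorm]; rfl
    _ ≤ _ := eLpNorm_smul_le_mul_eLpNorm hh.1 hu.1

namespace IsH10Pair

variable {f : Plane → F} {g : Fin 2 → Plane → F}

lemma integral_eq (h : IsH10Pair Ω f g) {χ : Plane → ℝ} (hχ : IsTestFunction Set.univ χ)
    (i : Fin 2) : ∫ x, classicalPartial i χ x • f x = - ∫ x, χ x • g i x := by
  -- The defect is bounded by a constant times the distance to any test function approximating `f`.
  set N : ℝ≥0∞ := eLpNorm (classicalPartial i χ) 2 volume + eLpNorm χ 2 volume with hN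
  have hNt : N ≠ ⊤ := ENNReal.add_ne_top.2 ⟨(hχ.classicalPartial i).memLp.2.ne, hχ.memLp.2.ne⟩
  have hint : ∀ {a : Plane → ℝ} {b : Plane → F}, MemLp a 2 volume → MemLp b 2 volume →
      Integrable fun x => a x • b x := fun ha hb => memLp_one_iff_integrable.1 (hb.smul ha)
  have key : ∀ ε : ℝ≥0∞, 0 < ε →
      ‖(∫ x, classicalPartial i χ x • f x) + ∫ x, χ x • g i x‖ₑ ≤ N * ε := by
    intro ε hε
    obtain ⟨φ, hφ, h1, h2⟩ := h.approx ε hε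
    have e1 : (∫ x, classicalPartial i χ x • f x) + ∫ x, χ x • g i x =
        (∫ x, classicalPartial i χ x • (f - φ) x) +
          ∫ x, χ x • (g i - classicalPartial i φ) x := by
      simp only [Pi.sub_apply, smul_sub]
      rw [integral_sub (hint (hχ.classicalPartial i).memLp h.memLp)
          (hint (hχ.classicalPartial i).memLp hφ.memLp),
        integral_sub (hint hχ.memLp (h.memLp_partial i))
          (hint hχ.memLp (hφ.classicalPartial i).memLp), hφ.integral_eq hχ]
      abel
    rw [e1, hN, add_mul]
    refine (enorm_add_le _ _).trans (add_le_add ?_ ?_)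
    · refine (enorm_integral_smul_le (hχ.classicalPartial i).memLp (h.memLp.sub hφ.memLp)).trans ?_
      gcongr
    · refine (enorm_integral_smul_le hχ.memLp
        ((h.memLp_partial i).sub (hφ.classicalPartial i).memLp)).trans ?_
      gcongr
      exact (h2 i).le
  have hlim : Tendsto (fun ε : ℝ≥0∞ => N * ε) (𝓝[>] 0) (𝓝 0) := by
    have : Tendsto (fun ε : ℝ≥0∞ => N * ε) (𝓝 0) (𝓝 (N * 0)) :=
      ENNReal.Tendsto.const_mul tendsto_id (Or.inr hNt)
    rw [mul_zero] at this
    exact this.mono_left nhdsWithin_le_nhds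
  have h0 : ‖(∫ x, classicalPartial i χ x • f x) + ∫ x, χ x • g i x‖ₑ ≤ 0 :=
    ge_of_tendsto hlim (by filter_upwards [self_mem_nhdsWithin] with ε hε using key ε hε)
  exact eq_neg_of_add_eq_zero_left (enorm_eq_zero.1 (le_antisymm h0 zero_le))

lemma isWeakPartial (h : IsH10Pair Ω f g) (i : Fin 2) : IsWeakPartial Ω i f (g i) := by
  refine ⟨(h.memLp.locallyIntegrable (by norm_num)).locallyIntegrableOn Ω,
    ((h.memLp_partial i).locallyIntegrable (by norm_num)).locallyIntegrableOn Ω, fun φ hφ => ?_⟩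
  rw [setIntegral_eq_integral_of_forall_compl_eq_zero (fun x hx => by simp [h.eq_zero x hx]),
    setIntegral_eq_integral_of_forall_compl_eq_zero
      (fun x hx => by simp [h.partial_eq_zero i x hx])]
  exact h.integral_eq ⟨hφ.1, hφ.2.1, Set.subset_univ _⟩ i

lemma memH10 [CompleteSpace F] (hΩ : IsOpen Ω) (h : IsH10Pair Ω f g) : MemH10 Ω f := by
  refine ⟨⟨h.memLp.restrict Ω, fun i => ⟨g i, h.isWeakPartial i, (h.memLp_partial i).restrict Ω⟩⟩,
    fun ε hε => ?_⟩
  obtain ⟨φ, hφ, h1, h2⟩ := h.approx ε hε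
  refine ⟨φ, hφ, (eLpNorm_mono_measure _ Measure.restrict_le_self).trans_lt h1, fun i => ?_⟩
  have : weakPartial Ω i f - classicalPartial i φ =ᵐ[volume.restrict Ω]
      g i - classicalPartial i φ := by
    filter_upwards [(h.isWeakPartial i).weakPartial_ae_eq hΩ] with x hx
    simp [hx]
  rw [eLpNorm_congr_ae this]
  exact (eLpNorm_mono_measure _ Measure.restrict_le_self).trans_lt (h2 i)

lemma add_testFunction (h : IsH10Pair Ω f g) {χ : Plane → F} (hχ : IsTestFunction Ω χ) :
    IsH10Pair Ω (f + χ) (fun i => g i + classicalPartial i χ) where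
  memLp := h.memLp.add hχ.memLp
  memLp_partial i := (h.memLp_partial i).add (hχ.classicalPartial i).memLp
  eq_zero x hx := by simp [h.eq_zero x hx, hχ.eq_zero hx]
  partial_eq_zero i x hx := by simp [h.partial_eq_zero i x hx, (hχ.classicalPartial i).eq_zero hx]
  approx ε hε := by
    obtain ⟨φ, hφ, h1, h2⟩ := h.approx ε hε
    refine ⟨φ + χ, hφ.add hχ, by rwa [add_sub_add_right_eq_sub], fun i => ?_⟩
    have : classicalPartial i (φ + χ) = classicalPartial i φ + classicalPartial i χ := by
      funext x
      simp [classicalPartial, fderiv_add (hφ.differentiable x) (hχ.differentiable x)]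
    rw [this, add_sub_add_right_eq_sub]
    exact h2 i

end IsH10Pair

lemma MemH10.isH10Pair [CompleteSpace F] (hΩ : IsOpen Ω) {f : Plane → F} (h : MemH10 Ω f) :
    IsH10Pair Ω (Ω.indicator f) (fun i => Ω.indicator (weakPartial Ω i f)) where
  memLp := (memLp_indicator_iff_restrict hΩ.measurableSet).2 h.1.1
  memLp_partial i := by
    obtain ⟨g, hg, hg2⟩ := h.1.2 i
    exact (memLp_indicator_iff_restrict hΩ.measurableSet).2
      (hg2.ae_eq (hg.weakPartial_ae_eq hΩ).symm)
  eq_zero x hx := Set.indicator_of_notMem hx _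
  partial_eq_zero i x hx := Set.indicator_of_notMem hx _
  approx ε hε := by
    obtain ⟨φ, hφ, h1, h2⟩ := h.2 ε hε
    have key : ∀ (u : Plane → F) {χ : Plane → F}, IsTestFunction Ω χ →
        Ω.indicator u - χ = Ω.indicator (u - χ) := by
      intro u χ hχ
      funext x
      by_cases hx : x ∈ Ω
      · simp [hx]
      · simp [hx, hχ.eq_zero hx]
    refine ⟨φ, hφ, ?_, fun i => ?_⟩
    · rw [key _ hφ, eLpNorm_indicator_eq_eLpNorm_restrict hΩ.measurableSet]
      exact h1
    · rw [key _ (hφ.classicalPartial i), eLpNorm_indicator_eq_eLpNorm_restrict hΩ.measurableSet]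
      exact h2 i

end Sobolev

/-! ### Diffeomorphisms of the plane close to the identity -/

section Shift

/-- The deformation `x ↦ x - η(x) v` of the plane in the direction `v`. -/
noncomputable def shift (η : Plane → ℝ) (v : Plane) (x : Plane) : Plane := x - η x • v

lemma fderiv_apply_eq {F : Type*} [NormedAddCommGroup F] [NormedSpace ℝ F] (φ : Plane → F)
    (x v : Plane) :
    fderiv ℝ φ x v = v 0 • classicalPartial 0 φ x + v 1 • classicalPartial 1 φ x := by
  have hv : v = v 0 • EuclideanSpace.single 0 1 + v 1 • EuclideanSpace.single 1 1 := by
    ext i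
    fin_cases i <;> simp
  conv_lhs => rw [hv]
  simp [classicalPartial]

/-- The hypotheses under which `shift η v` is a diffeomorphism of the plane that is `δ`-close to the
identity in `C¹`. -/
structure IsSmallShift (η : Plane → ℝ) (v : Plane) (δ : ℝ) : Prop where
  contDiff : ContDiff ℝ ∞ η
  hasCompactSupport : HasCompactSupport η
  norm_fderiv_le : ∀ x, ‖fderiv ℝ η x‖ ≤ δ
  le_half : δ ≤ 1 / 2
  norm_le : ‖v‖ ≤ 1

namespace IsSmallShift

variable {η : Plane → ℝ} {v : Plane} {δ : ℝ}

lemma nonneg (h : IsSmallShift η v δ) : 0 ≤ δ := (norm_nonneg _).trans (h.norm_fderiv_le 0)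

lemma contDiff_shift (h : IsSmallShift η v δ) : ContDiff ℝ ∞ (shift η v) :=
  contDiff_id.sub (h.contDiff.smul contDiff_const)

lemma continuous_shift (h : IsSmallShift η v δ) : Continuous (shift η v) :=
  h.contDiff_shift.continuous

lemma differentiable (h : IsSmallShift η v δ) : Differentiable ℝ η :=
  h.contDiff.differentiable (by simp)

lemma hasFDerivAt_shift (h : IsSmallShift η v δ) (x : Plane) :
    HasFDerivAt (shift η v)
      (ContinuousLinearMap.id ℝ Plane - (fderiv ℝ η x).smulRight v) x :=
  (hasFDerivAt_id x).sub ((h.differentiable x).hasFDerivAt.smul_const v)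

lemma det_fderiv_shift (η : Plane → ℝ) (v x : Plane) :
    (ContinuousLinearMap.id ℝ Plane - (fderiv ℝ η x).smulRight v).det = 1 - fderiv ℝ η x v := by
  have := LinearMap.transvection.det (-(fderiv ℝ η x : Plane →ₗ[ℝ] ℝ)) v
  rw [LinearMap.neg_apply, ← sub_eq_add_neg] at this
  refine Eq.trans ?_ this
  rw [ContinuousLinearMap.det]
  congr 1
  ext y : 1
  simp [LinearMap.transvection, sub_eq_add_neg]

lemma abs_fderiv_apply_le (h : IsSmallShift η v δ) (x : Plane) : |fderiv ℝ η x v| ≤ δ := by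
  calc |fderiv ℝ η x v| ≤ ‖fderiv ℝ η x‖ * ‖v‖ := (fderiv ℝ η x).le_opNorm v
    _ ≤ δ * 1 := mul_le_mul (h.norm_fderiv_le x) h.norm_le (norm_nonneg _) h.nonneg
    _ = δ := mul_one δ

lemma abs_classicalPartial_le (h : IsSmallShift η v δ) (i : Fin 2) (x : Plane) :
    |classicalPartial i η x| ≤ δ := by
  calc |classicalPartial i η x| ≤ ‖fderiv ℝ η x‖ * ‖(EuclideanSpace.single i 1 : Plane)‖ :=
        (fderiv ℝ η x).le_opNorm _
    _ ≤ δ := by simpa using h.norm_fderiv_le x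

lemma abs_coord_le (h : IsSmallShift η v δ) (i : Fin 2) : |v i| ≤ 1 :=
  (PiLp.norm_apply_le v i).trans h.norm_le

lemma bijective_shift (h : IsSmallShift η v δ) : Function.Bijective (shift η v) := by
  have hδ : (δ.toNNReal : ℝ) = δ := Real.coe_toNNReal δ h.nonneg
  have hlip : LipschitzWith δ.toNNReal η :=
    lipschitzWith_of_nnnorm_fderiv_le h.differentiable fun x => by
      rw [← NNReal.coe_le_coe, hδ]
      exact h.norm_fderiv_le x
  have happ : ApproximatesLinearOn (shift η v)
      ((ContinuousLinearEquiv.refl ℝ Plane : Plane ≃L[ℝ] Plane) : Plane →L[ℝ] Plane) Set.univ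
      δ.toNNReal := by
    intro x _ y _
    have e : shift η v x - shift η v y -
        ((ContinuousLinearEquiv.refl ℝ Plane : Plane ≃L[ℝ] Plane) : Plane →L[ℝ] Plane) (x - y) =
        (η y - η x) • v := by
      simp only [shift, ContinuousLinearEquiv.coe_refl, ContinuousLinearMap.id_apply, sub_smul]
      abel
    rw [e, norm_smul]
    have h1 := hlip.dist_le_mul y x
    rw [dist_eq_norm, dist_eq_norm, norm_sub_rev y x] at h1
    calc ‖η y - η x‖ * ‖v‖ ≤ ‖η y - η x‖ * 1 := by gcongr; exact h.norm_le
      _ ≤ _ := by simpa using h1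
  have hc : δ.toNNReal <
      ‖((ContinuousLinearEquiv.refl ℝ Plane).symm : Plane →L[ℝ] Plane)‖₊⁻¹ := by
    have : ‖((ContinuousLinearEquiv.refl ℝ Plane).symm : Plane →L[ℝ] Plane)‖₊ = 1 := by
      have : ((ContinuousLinearEquiv.refl ℝ Plane).symm : Plane →L[ℝ] Plane) =
        ContinuousLinearMap.id ℝ Plane := rfl
      rw [this, ContinuousLinearMap.nnnorm_id]
    rw [this, inv_one, ← NNReal.coe_lt_coe]
    have := h.le_half
    rw [hδ, NNReal.coe_one]
    linarith
  exact (happ.toHomeomorph (shift η v) (Or.inr hc)).bijective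

/-- Change of variables for `shift η v`. -/
lemma integral_eq {E : Type*} [NormedAddCommGroup E] [NormedSpace ℝ E] (h : IsSmallShift η v δ)
    (u : Plane → E) :
    ∫ x, u x = ∫ x, (1 - fderiv ℝ η x v) • u (shift η v x) := by
  have := integral_image_eq_integral_abs_det_fderiv_smul volume MeasurableSet.univ
    (fun x _ => (h.hasFDerivAt_shift x).hasFDerivWithinAt) h.bijective_shift.1.injOn u
  rw [Set.image_univ, h.bijective_shift.2.range_eq, setIntegral_univ, setIntegral_univ] at this
  rw [this]
  congr 1
  funext x
  have h1 := abs_le.1 (h.abs_fderiv_apply_le x)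
  have h2 := h.le_half
  rw [det_fderiv_shift, abs_of_nonneg (by linarith)]

/-- The Jacobian is at least `1 / 2`, so `shift η v` at most doubles the measure of preimages. -/
lemma map_volume_le (h : IsSmallShift η v δ) :
    Measure.map (shift η v) volume ≤ (2 : ℝ≥0∞) • volume := by
  refine Measure.le_iff.2 fun s hs => ?_
  have hm := h.continuous_shift.measurable
  rw [Measure.map_apply hm hs, Measure.smul_apply, smul_eq_mul]
  have h1 := lintegral_image_eq_lintegral_abs_det_fderiv_mul volume (hm hs)
    (fun x _ => (h.hasFDerivAt_shift x).hasFDerivWithinAt) h.bijective_shift.1.injOn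
    (fun _ => 1)
  rw [Set.image_preimage_eq s h.bijective_shift.2, setLIntegral_one] at h1
  have h2 : (2 : ℝ≥0∞)⁻¹ * volume (shift η v ⁻¹' s) ≤ volume s := by
    rw [h1, ← setLIntegral_const]
    refine setLIntegral_mono_ae' (hm hs) (Eventually.of_forall fun x _ => ?_)
    have h1 := abs_le.1 (h.abs_fderiv_apply_le x)
    have h2 := h.le_half
    rw [det_fderiv_shift, abs_of_nonneg (by linarith), mul_one]
    rw [show (2 : ℝ≥0∞)⁻¹ = ENNReal.ofReal (1 / 2) by
      rw [one_div, ENNReal.ofReal_inv_of_pos (by norm_num)]; norm_num]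
    exact ENNReal.ofReal_le_ofReal (by linarith)
  calc volume (shift η v ⁻¹' s) = 2 * ((2 : ℝ≥0∞)⁻¹ * volume (shift η v ⁻¹' s)) := by
        rw [← mul_assoc, ENNReal.mul_inv_cancel (by norm_num) (by norm_num), one_mul]
    _ ≤ 2 * volume s := by gcongr

lemma quasiMeasurePreserving (h : IsSmallShift η v δ) :
    Measure.QuasiMeasurePreserving (shift η v) volume volume :=
  ⟨h.continuous_shift.measurable,
    (h.map_volume_le.absolutelyContinuous).trans (Measure.smul_absolutelyContinuous)⟩

variable {F : Type*} [NormedAddCommGroup F] [NormedSpace ℝ F]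

omit [NormedSpace ℝ F] in
lemma eLpNorm_comp_le (h : IsSmallShift η v δ) {u : Plane → F}
    (hu : AEStronglyMeasurable u volume) :
    eLpNorm (u ∘ shift η v) 2 volume ≤ 2 * eLpNorm u 2 volume := by
  rw [← eLpNorm_map_measure (hu.mono_ac h.quasiMeasurePreserving.2)
    h.continuous_shift.measurable.aemeasurable]
  refine (eLpNorm_mono_measure u h.map_volume_le).trans ?_
  rw [eLpNorm_smul_measure_of_ne_top (by norm_num), smul_eq_mul]
  gcongr
  calc (2 : ℝ≥0∞) ^ (1 / (2 : ℝ≥0∞)).toReal ≤ 2 ^ (1 : ℝ) :=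
        ENNReal.rpow_le_rpow_of_exponent_le (by norm_num) (by norm_num)
    _ = 2 := ENNReal.rpow_one 2

omit [NormedSpace ℝ F] in
lemma memLp_comp (h : IsSmallShift η v δ) {u : Plane → F} (hu : MemLp u 2 volume) :
    MemLp (u ∘ shift η v) 2 volume :=
  ⟨hu.1.comp_quasiMeasurePreserving h.quasiMeasurePreserving,
    (h.eLpNorm_comp_le hu.1).trans_lt (ENNReal.mul_lt_top (by norm_num) hu.2)⟩

end IsSmallShift

variable {F : Type*} [NormedAddCommGroup F] [NormedSpace ℝ F] {η : Plane → ℝ} {v : Plane} {δ : ℝ}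

/-- The gradient of `f ∘ shift η v`, as given by the chain rule, if `g` is the gradient of `f`. -/
noncomputable def shiftGradient (η : Plane → ℝ) (v : Plane) (g : Fin 2 → Plane → F) (i : Fin 2)
    (x : Plane) : F :=
  g i (shift η v x) -
    classicalPartial i η x • (v 0 • g 0 (shift η v x) + v 1 • g 1 (shift η v x))

lemma norm_shiftGradient_le (h : IsSmallShift η v δ) (g : Fin 2 → Plane → F) (i : Fin 2)
    (x : Plane) : ‖shiftGradient η v g i x‖ ≤
      ‖g i (shift η v x)‖ + ‖g 0 (shift η v x)‖ + ‖g 1 (shift η v x)‖ := by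
  have h1 : |classicalPartial i η x| ≤ 1 :=
    (h.abs_classicalPartial_le i x).trans (h.le_half.trans (by norm_num))
  calc ‖shiftGradient η v g i x‖ ≤ ‖g i (shift η v x)‖ + |classicalPartial i η x| *
        (|v 0| * ‖g 0 (shift η v x)‖ + |v 1| * ‖g 1 (shift η v x)‖) := by
        refine (norm_sub_le _ _).trans ?_
        rw [norm_smul, Real.norm_eq_abs]
        gcongr
        refine (norm_add_le _ _).trans ?_
        rw [norm_smul, norm_smul, Real.norm_eq_abs, Real.norm_eq_abs]
    _ ≤ ‖g i (shift η v x)‖ + 1 * (1 * ‖g 0 (shift η v x)‖ + 1 * ‖g 1 (shift η v x)‖) := by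
        gcongr
        · exact h.abs_coord_le 0
        · exact h.abs_coord_le 1
    _ = _ := by ring

lemma aestronglyMeasurable_shiftGradient (h : IsSmallShift η v δ) {g : Fin 2 → Plane → F}
    (hg : ∀ i, MemLp (g i) 2 volume) (i : Fin 2) :
    AEStronglyMeasurable (shiftGradient η v g i) volume := by
  have hη : Continuous (classicalPartial i η) :=
    (h.contDiff.continuous_fderiv (by simp)).clm_apply continuous_const
  have hc := fun j => (h.memLp_comp (hg j)).1
  exact (hc i).sub (hη.aestronglyMeasurable.smul (((hc 0).const_smul _).add ((hc 1).const_smul _)))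

lemma eLpNorm_shiftGradient_le (h : IsSmallShift η v δ) {g : Fin 2 → Plane → F}
    (hg : ∀ i, MemLp (g i) 2 volume) (i : Fin 2) :
    eLpNorm (shiftGradient η v g i) 2 volume ≤
      2 * (eLpNorm (g i) 2 volume + eLpNorm (g 0) 2 volume + eLpNorm (g 1) 2 volume) := by
  have hc := fun j => (h.memLp_comp (hg j)).1.norm
  calc eLpNorm (shiftGradient η v g i) 2 volume
      ≤ eLpNorm ((fun x => ‖(g i ∘ shift η v) x‖) + (fun x => ‖(g 0 ∘ shift η v) x‖) +
          fun x => ‖(g 1 ∘ shift η v) x‖) 2 volume :=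
        eLpNorm_mono_real fun x => norm_shiftGradient_le h g i x
    _ ≤ eLpNorm (g i ∘ shift η v) 2 volume + eLpNorm (g 0 ∘ shift η v) 2 volume +
          eLpNorm (g 1 ∘ shift η v) 2 volume := by
        refine (eLpNorm_add_le ((hc i).add (hc 0)) (hc 1) (by norm_num)).trans ?_
        rw [eLpNorm_norm (g 1 ∘ shift η v)]
        gcongr
        refine (eLpNorm_add_le (hc i) (hc 0) (by norm_num)).trans ?_
        rw [eLpNorm_norm, eLpNorm_norm]
    _ ≤ _ := by
        rw [mul_add, mul_add]
        gcongr <;> exact h.eLpNorm_comp_le (hg _).1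

lemma memLp_shiftGradient (h : IsSmallShift η v δ) {g : Fin 2 → Plane → F}
    (hg : ∀ i, MemLp (g i) 2 volume) (i : Fin 2) : MemLp (shiftGradient η v g i) 2 volume :=
  ⟨aestronglyMeasurable_shiftGradient h hg i,
    (eLpNorm_shiftGradient_le h hg i).trans_lt (ENNReal.mul_lt_top (by norm_num)
      (ENNReal.add_lt_top.2 ⟨ENNReal.add_lt_top.2 ⟨(hg i).2, (hg 0).2⟩, (hg 1).2⟩))⟩

lemma isTestFunction_comp_shift (h : IsSmallShift η v δ) {Ω : Set Plane}
    (hΩ : shift η v ⁻¹' Ω ⊆ Ω) {φ : Plane → F} (hφ : IsTestFunction Ω φ) :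
    IsTestFunction Ω (φ ∘ shift η v) := by
  have hsub : tsupport (φ ∘ shift η v) ⊆ shift η v ⁻¹' tsupport φ :=
    closure_minimal (fun x hx => subset_tsupport φ hx)
      ((isClosed_tsupport φ).preimage h.continuous_shift)
  refine ⟨hφ.1.comp h.contDiff_shift, ?_, hsub.trans ((Set.preimage_mono hφ.2.2).trans hΩ)⟩
  obtain ⟨R, hR⟩ := hφ.2.1.isBounded.exists_norm_le
  obtain ⟨C, hC⟩ := h.contDiff.continuous.bounded_above_of_compact_support h.hasCompactSupport
  refine Metric.isCompact_of_isClosed_isBounded (isClosed_tsupport _)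
    (isBounded_iff_forall_norm_le.2 ⟨R + C * 1, fun x hx => ?_⟩)
  have h1 : x = shift η v x + η x • v := by simp [shift]
  have hC0 : 0 ≤ C := (norm_nonneg _).trans (hC x)
  calc ‖x‖ = ‖shift η v x + η x • v‖ := by rw [← h1]
    _ ≤ ‖shift η v x‖ + ‖η x‖ * ‖v‖ := by rw [← norm_smul]; exact norm_add_le _ _
    _ ≤ R + C * 1 := by
        gcongr
        · exact hR _ (hsub hx)
        · exact hC x
        · exact h.norm_le

lemma classicalPartial_comp_shift (h : IsSmallShift η v δ) {φ : Plane → F}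
    (hφ : Differentiable ℝ φ) (i : Fin 2) :
    classicalPartial i (φ ∘ shift η v) = shiftGradient η v (fun j => classicalPartial j φ) i := by
  funext x
  rw [shiftGradient, ← fderiv_apply_eq φ (shift η v x) v]
  rw [classicalPartial, ((hφ _).hasFDerivAt.comp x (h.hasFDerivAt_shift x)).fderiv]
  simp [classicalPartial]

/-- `H¹₀(Ω)` is preserved by composition with a shift that does not move any point outside of `Ω`
into `Ω`. -/
lemma IsH10Pair.comp_shift {Ω : Set Plane} {f : Plane → F} {g : Fin 2 → Plane → F}
    (hfg : IsH10Pair Ω f g) (h : IsSmallShift η v δ) (hΩ : shift η v ⁻¹' Ω ⊆ Ω) :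
    IsH10Pair Ω (f ∘ shift η v) (shiftGradient η v g) where
  memLp := h.memLp_comp hfg.memLp
  memLp_partial := memLp_shiftGradient h hfg.memLp_partial
  eq_zero x hx := hfg.eq_zero _ fun hx' => hx (hΩ hx')
  partial_eq_zero i x hx := by
    have := fun j => hfg.partial_eq_zero j _ fun hx' => hx (hΩ hx')
    simp [shiftGradient, this]
  approx ε hε := by
    obtain ⟨φ, hφ, h1, h2⟩ := hfg.approx (ε / 6) (ENNReal.div_pos hε.ne' (by norm_num))
    have h6 : ∀ a : ℝ≥0∞, a < ε / 6 → 6 * a < ε := fun a ha => by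
      rw [mul_comm]
      exact (ENNReal.lt_div_iff_mul_lt (by norm_num) (by norm_num)).1 ha
    refine ⟨φ ∘ shift η v, isTestFunction_comp_shift h hΩ hφ, ?_, fun i => ?_⟩
    · refine lt_of_le_of_lt ?_ (h6 _ h1)
      refine (h.eLpNorm_comp_le (hfg.memLp.sub hφ.memLp).1).trans ?_
      gcongr
      norm_num
    · have hd : shiftGradient η v g i - classicalPartial i (φ ∘ shift η v) =
          shiftGradient η v (fun j => g j - classicalPartial j φ) i := by
        rw [classicalPartial_comp_shift h hφ.differentiable]
        funext x
        simp only [shiftGradient, Pi.sub_apply, smul_sub, smul_add]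
        abel
      rw [hd]
      have hM : max (eLpNorm (g 0 - classicalPartial 0 φ) 2 volume)
          (eLpNorm (g 1 - classicalPartial 1 φ) 2 volume) < ε / 6 := max_lt (h2 0) (h2 1)
      refine lt_of_le_of_lt ?_ (h6 _ hM)
      refine (eLpNorm_shiftGradient_le h
        (fun j => (hfg.memLp_partial j).sub (hφ.classicalPartial j).memLp) i).trans ?_
      set M := max (eLpNorm (g 0 - classicalPartial 0 φ) 2 volume)
          (eLpNorm (g 1 - classicalPartial 1 φ) 2 volume) with hMdef
      have hle : ∀ j, eLpNorm (g j - classicalPartial j φ) 2 volume ≤ M := by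
        intro j
        fin_cases j
        · exact le_max_left _ _
        · exact le_max_right _ _
      calc 2 * (eLpNorm (g i - classicalPartial i φ) 2 volume +
            eLpNorm (g 0 - classicalPartial 0 φ) 2 volume +
            eLpNorm (g 1 - classicalPartial 1 φ) 2 volume) ≤ 2 * (M + M + M) := by
            gcongr <;> exact hle _
        _ = 6 * M := by ring

end Shift

/-! ### Pointwise estimates for the energy and degree densities -/

section Densities

/-- The integrand of `energy`, as a function of the value `p` of the map and of its partial
derivatives `a` and `b`. -/
noncomputable def energyDensity (κ Q : ℝ) (p a b : Space) : ℝ :=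
  (‖a‖ ^ 2 + ‖b‖ ^ 2) - 2 * κ * (p 0 * a 2 + p 1 * b 2) + (Q - 1) * (p 0 ^ 2 + p 1 ^ 2)

/-- The integrand of `degree` (without the factor `1 / 4π`), as a function of the value `p` of the
map and of its partial derivatives `a` and `b`. -/
noncomputable def degreeDensity (p a b : Space) : ℝ := p.ofLp ⬝ᵥ (a.ofLp ⨯₃ b.ofLp)

lemma degreeDensity_eq (p a b : Space) : degreeDensity p a b =
    p 0 * (a 1 * b 2 - a 2 * b 1) + p 1 * (a 2 * b 0 - a 0 * b 2)
      + p 2 * (a 0 * b 1 - a 1 * b 0) := by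
  rw [degreeDensity, cross_apply, Matrix.vec3_dotProduct]
  rfl

lemma norm_sq_eq (a : Space) : ‖a‖ ^ 2 = a 0 ^ 2 + a 1 ^ 2 + a 2 ^ 2 := by
  rw [EuclideanSpace.real_norm_sq_eq, Fin.sum_univ_three]

lemma e3_apply (i : Fin 3) : e3 i = if i = 2 then 1 else 0 := by
  simp [e3]

@[simp] lemma norm_e3 : ‖e3‖ = 1 := by simp [e3]

@[simp] lemma energyDensity_sub_e3 (κ Q : ℝ) (p a b : Space) :
    energyDensity κ Q (p - e3) a b = energyDensity κ Q p a b := by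
  simp [energyDensity, e3_apply]

@[simp] lemma energyDensity_zero (κ Q : ℝ) : energyDensity κ Q 0 0 0 = 0 := by
  simp [energyDensity]

@[simp] lemma degreeDensity_zero (p : Space) : degreeDensity p 0 0 = 0 := by
  simp [degreeDensity_eq]

lemma abs_degreeDensity_le (p a b : Space) :
    |degreeDensity p a b| ≤ 3 * ‖p‖ * (‖a‖ ^ 2 + ‖b‖ ^ 2) := by
  have hp := fun i => PiLp.norm_apply_le p i
  have key : ∀ (i : Fin 3) (x y z w : ℝ), x ^ 2 + y ^ 2 ≤ ‖a‖ ^ 2 → z ^ 2 + w ^ 2 ≤ ‖b‖ ^ 2 →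
      |p i * (x * z - y * w)| ≤ ‖p‖ * (‖a‖ ^ 2 + ‖b‖ ^ 2) := by
    intro i x y z w h1 h2
    rw [abs_mul]
    refine mul_le_mul (hp i) ?_ (abs_nonneg _) (norm_nonneg _)
    rw [abs_le]
    constructor <;> nlinarith [sq_nonneg (x + z), sq_nonneg (x - z), sq_nonneg (y + w),
      sq_nonneg (y - w), sq_nonneg x, sq_nonneg y, sq_nonneg z, sq_nonneg w]
  have ha := norm_sq_eq a
  have hb := norm_sq_eq b
  have h0 := key 0 (a 1) (a 2) (b 2) (b 1) (by nlinarith [sq_nonneg (a 0)])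
    (by nlinarith [sq_nonneg (b 0)])
  have h1 := key 1 (a 2) (a 0) (b 0) (b 2) (by nlinarith [sq_nonneg (a 1)])
    (by nlinarith [sq_nonneg (b 1)])
  have h2 := key 2 (a 0) (a 1) (b 1) (b 0) (by nlinarith [sq_nonneg (a 2)])
    (by nlinarith [sq_nonneg (b 2)])
  rw [degreeDensity_eq]
  refine (abs_add_le _ _).trans ?_
  have := abs_add_le (p 0 * (a 1 * b 2 - a 2 * b 1)) (p 1 * (a 2 * b 0 - a 0 * b 2))
  linarith

lemma abs_coord_mul_le (p a : Space) (i j : Fin 3) : |p i * a j| ≤ ‖p‖ * ‖a‖ := by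
  rw [abs_mul]
  exact mul_le_mul (PiLp.norm_apply_le p i) (PiLp.norm_apply_le a j) (abs_nonneg _) (norm_nonneg _)

lemma abs_energyDensity_le (κ Q : ℝ) (p a b : Space) :
    |energyDensity κ Q p a b| ≤
      (1 + 2 * |κ| + |Q - 1|) * (‖p‖ ^ 2 + ‖a‖ ^ 2 + ‖b‖ ^ 2) := by
  have h1 : |p 0 * a 2 + p 1 * b 2| ≤ ‖p‖ ^ 2 + ‖a‖ ^ 2 + ‖b‖ ^ 2 := by
    refine (abs_add_le _ _).trans ?_
    have := abs_coord_mul_le p a 0 2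
    have := abs_coord_mul_le p b 1 2
    nlinarith [sq_nonneg (‖p‖ - ‖a‖), sq_nonneg (‖p‖ - ‖b‖), sq_nonneg ‖a‖, sq_nonneg ‖b‖]
  have h2 : |p 0 ^ 2 + p 1 ^ 2| ≤ ‖p‖ ^ 2 + ‖a‖ ^ 2 + ‖b‖ ^ 2 := by
    rw [abs_of_nonneg (by positivity)]
    nlinarith [norm_sq_eq p, sq_nonneg (p 2), sq_nonneg ‖a‖, sq_nonneg ‖b‖]
  have h3 : |‖a‖ ^ 2 + ‖b‖ ^ 2| ≤ ‖p‖ ^ 2 + ‖a‖ ^ 2 + ‖b‖ ^ 2 := by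
    rw [abs_of_nonneg (by positivity)]
    nlinarith [sq_nonneg ‖p‖]
  calc |energyDensity κ Q p a b| ≤ |‖a‖ ^ 2 + ‖b‖ ^ 2| + |2 * κ * (p 0 * a 2 + p 1 * b 2)|
        + |(Q - 1) * (p 0 ^ 2 + p 1 ^ 2)| :=
        (abs_add_le _ _).trans (add_le_add_left (abs_sub _ _) _)
    _ = |‖a‖ ^ 2 + ‖b‖ ^ 2| + 2 * |κ| * |p 0 * a 2 + p 1 * b 2|
        + |Q - 1| * |p 0 ^ 2 + p 1 ^ 2| := by
        rw [abs_mul, abs_mul, abs_mul, abs_two]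
    _ ≤ 1 * (‖p‖ ^ 2 + ‖a‖ ^ 2 + ‖b‖ ^ 2) + 2 * |κ| * (‖p‖ ^ 2 + ‖a‖ ^ 2 + ‖b‖ ^ 2)
        + |Q - 1| * (‖p‖ ^ 2 + ‖a‖ ^ 2 + ‖b‖ ^ 2) := by
        rw [one_mul]
        gcongr
    _ = _ := by ring

/-- A rank one perturbation of the gradient multiplies the degree density by a determinant. -/
lemma degreeDensity_sub_smul (p a b : Space) (v₀ v₁ c₀ c₁ : ℝ) :
    degreeDensity p (a - c₀ • (v₀ • a + v₁ • b)) (b - c₁ • (v₀ • a + v₁ • b)) =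
      (1 - (v₀ * c₀ + v₁ * c₁)) * degreeDensity p a b := by
  simp only [degreeDensity_eq, PiLp.sub_apply, PiLp.add_apply, PiLp.smul_apply, smul_eq_mul]
  ring

/-- Under a rank one perturbation of size `δ` of the gradient, the energy density changes by
`O(δ)`. -/
lemma abs_energyDensity_sub_smul_le (κ Q : ℝ) (p a b : Space) {v₀ v₁ c₀ c₁ D δ : ℝ}
    (hv₀ : |v₀| ≤ 1) (hv₁ : |v₁| ≤ 1) (hc₀ : |c₀| ≤ δ) (hc₁ : |c₁| ≤ δ) (hD : |1 - D| ≤ δ)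
    (hδ : δ ≤ 1) :
    |energyDensity κ Q p (a - c₀ • (v₀ • a + v₁ • b)) (b - c₁ • (v₀ • a + v₁ • b)) -
        D * energyDensity κ Q p a b| ≤
      (13 + 10 * |κ| + |Q - 1|) * δ * (‖p‖ ^ 2 + ‖a‖ ^ 2 + ‖b‖ ^ 2) := by
  set w := v₀ • a + v₁ • b with hw
  set R := ‖p‖ ^ 2 + ‖a‖ ^ 2 + ‖b‖ ^ 2 with hR
  have hδ0 : 0 ≤ δ := (abs_nonneg _).trans hc₀
  have hwn : ‖w‖ ≤ ‖a‖ + ‖b‖ := by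
    refine (norm_add_le _ _).trans ?_
    rw [norm_smul, norm_smul, Real.norm_eq_abs, Real.norm_eq_abs]
    nlinarith [norm_nonneg a, norm_nonneg b]
  have hsq : ∀ (c : ℝ) (u : Space), |c| ≤ δ → ‖u‖ ≤ ‖a‖ + ‖b‖ →
      |‖u - c • w‖ ^ 2 - ‖u‖ ^ 2| ≤ 6 * δ * R := by
    intro c u hc hu
    have h1 : ‖c • w‖ ≤ δ * (‖a‖ + ‖b‖) := by
      rw [norm_smul, Real.norm_eq_abs]
      exact mul_le_mul hc hwn (norm_nonneg _) hδ0
    have h2 : |‖u - c • w‖ - ‖u‖| ≤ δ * (‖a‖ + ‖b‖) := by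
      refine (abs_norm_sub_norm_le _ _).trans ?_
      rwa [sub_sub_cancel_left, norm_neg]
    have h3 : |‖u - c • w‖ + ‖u‖| ≤ 3 * (‖a‖ + ‖b‖) := by
      rw [abs_of_nonneg (by positivity)]
      have := norm_sub_le u (c • w)
      nlinarith [norm_nonneg a, norm_nonneg b]
    rw [show ‖u - c • w‖ ^ 2 - ‖u‖ ^ 2 = (‖u - c • w‖ - ‖u‖) * (‖u - c • w‖ + ‖u‖) by ring,
      abs_mul]
    calc _ ≤ (δ * (‖a‖ + ‖b‖)) * (3 * (‖a‖ + ‖b‖)) :=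
          mul_le_mul h2 h3 (abs_nonneg _) (by positivity)
      _ = 3 * δ * (‖a‖ + ‖b‖) ^ 2 := by ring
      _ ≤ 3 * δ * (2 * R) := by
          gcongr
          nlinarith [sq_nonneg (‖a‖ - ‖b‖), sq_nonneg ‖p‖]
      _ = 6 * δ * R := by ring
  have hcross : ∀ (c : ℝ) (i : Fin 3), |c| ≤ δ → |c * (p i * w 2)| ≤ 2 * δ * R := by
    intro c i hc
    rw [abs_mul]
    calc |c| * |p i * w 2| ≤ δ * (2 * R) := by
          refine mul_le_mul hc ((abs_coord_mul_le p w i 2).trans ?_) (abs_nonneg _) hδ0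
          nlinarith [norm_nonneg p, norm_nonneg a, norm_nonneg b, sq_nonneg (‖p‖ - ‖a‖),
            sq_nonneg (‖p‖ - ‖b‖), sq_nonneg ‖a‖, sq_nonneg ‖b‖, sq_nonneg ‖p‖]
      _ = _ := by ring
  have e : energyDensity κ Q p (a - c₀ • w) (b - c₁ • w) - D * energyDensity κ Q p a b =
      (‖a - c₀ • w‖ ^ 2 - ‖a‖ ^ 2) + (‖b - c₁ • w‖ ^ 2 - ‖b‖ ^ 2)
        + 2 * κ * (c₀ * (p 0 * w 2) + c₁ * (p 1 * w 2)) + (1 - D) * energyDensity κ Q p a b := by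
    simp only [energyDensity, PiLp.sub_apply, PiLp.smul_apply, smul_eq_mul]
    ring
  have hA := hsq c₀ a hc₀ (by linarith [norm_nonneg b])
  have hB := hsq c₁ b hc₁ (by linarith [norm_nonneg a])
  have hC : |2 * κ * (c₀ * (p 0 * w 2) + c₁ * (p 1 * w 2))| ≤ 2 * |κ| * (4 * δ * R) := by
    rw [abs_mul, abs_mul, abs_two]
    gcongr
    refine (abs_add_le _ _).trans ?_
    linarith [hcross c₀ 0 hc₀, hcross c₁ 1 hc₁]
  have hE : |(1 - D) * energyDensity κ Q p a b| ≤ δ * ((1 + 2 * |κ| + |Q - 1|) * R) := by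
    rw [abs_mul]
    exact mul_le_mul hD (abs_energyDensity_le κ Q p a b) (abs_nonneg _) hδ0
  rw [e]
  refine (abs_add_le _ _).trans ?_
  have h5 := abs_add_le ((‖a - c₀ • w‖ ^ 2 - ‖a‖ ^ 2) + (‖b - c₁ • w‖ ^ 2 - ‖b‖ ^ 2))
    (2 * κ * (c₀ * (p 0 * w 2) + c₁ * (p 1 * w 2)))
  have h6 := abs_add_le (‖a - c₀ • w‖ ^ 2 - ‖a‖ ^ 2) (‖b - c₁ • w‖ ^ 2 - ‖b‖ ^ 2)
  linarith

end Densities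

/-! ### Truncated Belavin-Polyakov skyrmions -/

section Bubble

/-- The squared distance of two points of the plane, in coordinates. -/
def sqDist (x₀ x : Plane) : ℝ := (x 0 - x₀ 0) ^ 2 + (x 1 - x₀ 1) ^ 2

lemma sqDist_eq (x₀ x : Plane) : sqDist x₀ x = ‖x - x₀‖ ^ 2 := by
  rw [EuclideanSpace.real_norm_sq_eq, Fin.sum_univ_two]
  rfl

lemma sqDist_nonneg (x₀ x : Plane) : 0 ≤ sqDist x₀ x := by
  rw [sqDist_eq]; positivity

/-- The third component plus one of the skyrmion profile, as a function of the squared distance `s`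
to the center. -/
noncomputable def bubbleHeight (c : ℝ → ℝ) (s : ℝ) : ℝ := 2 * c s ^ 2 / (c s ^ 2 + s)

/-- The factor of the horizontal components of the skyrmion profile, as a function of the squared
distance `s` to the center. -/
noncomputable def bubbleSlope (c : ℝ → ℝ) (s : ℝ) : ℝ := 2 * c s / (c s ^ 2 + s)

/-- The sum of `e₃` and of the inverse stereographic projection of `y ↦ c(|y|²) y / |y|²`, where
`y = x - x₀`. For constant `c` this is a Belavin-Polyakov skyrmion. -/
noncomputable def bubble (c : ℝ → ℝ) (x₀ x : Plane) : Space :=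
  !₂[bubbleSlope c (sqDist x₀ x) * (x 0 - x₀ 0), bubbleSlope c (sqDist x₀ x) * (x 1 - x₀ 1),
    bubbleHeight c (sqDist x₀ x)]

/-- The conditions on the profile `c` of a truncated skyrmion of radius `ρ`. The condition `c 0 ≠ 0`
keeps the denominator `c(s)² + s` positive for `s ≥ 0`, so that the profile is smooth at its
center. -/
structure IsBubbleProfile (c : ℝ → ℝ) (ρ : ℝ) : Prop where
  contDiff : ContDiff ℝ ∞ c
  ne_zero : c 0 ≠ 0
  eq_zero : ∀ s, ρ ^ 2 ≤ s → c s = 0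
  pos : 0 < ρ

namespace IsBubbleProfile

variable {c : ℝ → ℝ} {ρ : ℝ}

lemma denom_pos (h : IsBubbleProfile c ρ) {s : ℝ} (hs : 0 ≤ s) : 0 < c s ^ 2 + s := by
  rcases hs.eq_or_lt with rfl | hs
  · have := h.ne_zero
    positivity
  · positivity

lemma hasDerivAt (h : IsBubbleProfile c ρ) (s : ℝ) : HasDerivAt c (deriv c s) s :=
  ((h.contDiff.differentiable (by simp)) s).hasDerivAt

lemma hasDerivAt_bubbleHeight (h : IsBubbleProfile c ρ) {s : ℝ} (hs : 0 ≤ s) :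
    HasDerivAt (bubbleHeight c)
      ((4 * c s * deriv c s * s - 2 * c s ^ 2) / (c s ^ 2 + s) ^ 2) s := by
  have hc := h.hasDerivAt s
  have := ((hc.fun_pow 2).const_mul 2).fun_div ((hc.fun_pow 2).fun_add (hasDerivAt_id s))
    (h.denom_pos hs).ne'
  refine this.congr_deriv ?_
  congr 1
  simp
  ring

lemma hasDerivAt_bubbleSlope (h : IsBubbleProfile c ρ) {s : ℝ} (hs : 0 ≤ s) :
    HasDerivAt (bubbleSlope c)
      ((2 * deriv c s * (s - c s ^ 2) - 2 * c s) / (c s ^ 2 + s) ^ 2) s := by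
  have hc := h.hasDerivAt s
  have := (hc.const_mul 2).fun_div ((hc.fun_pow 2).fun_add (hasDerivAt_id s)) (h.denom_pos hs).ne'
  refine this.congr_deriv ?_
  congr 1
  simp
  ring

end IsBubbleProfile

lemma contDiff_coord (i : Fin 2) : ContDiff ℝ ∞ fun x : Plane => x i :=
  (EuclideanSpace.proj i : Plane →L[ℝ] ℝ).contDiff

lemma contDiff_sqDist (x₀ : Plane) : ContDiff ℝ ∞ (sqDist x₀) :=
  (((contDiff_coord 0).sub contDiff_const).pow 2).add (((contDiff_coord 1).sub contDiff_const).pow 2)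

lemma hasFDerivAt_coord_sub (x₀ x : Plane) (i : Fin 2) :
    HasFDerivAt (fun y : Plane => y i - x₀ i) (EuclideanSpace.proj i : Plane →L[ℝ] ℝ) x :=
  (EuclideanSpace.proj i : Plane →L[ℝ] ℝ).hasFDerivAt.sub_const _

lemma hasFDerivAt_sqDist (x₀ x : Plane) :
    HasFDerivAt (sqDist x₀) ((2 * (x 0 - x₀ 0)) • (EuclideanSpace.proj 0 : Plane →L[ℝ] ℝ) +
      (2 * (x 1 - x₀ 1)) • (EuclideanSpace.proj 1 : Plane →L[ℝ] ℝ)) x := by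
  have := ((hasFDerivAt_coord_sub x₀ x 0).pow 2).fun_add
    ((hasFDerivAt_coord_sub x₀ x 1).pow 2)
  refine this.congr_fderiv ?_
  ext v
  simp

lemma classicalPartial_apply {φ : Plane → Space} {x : Plane} (hφ : DifferentiableAt ℝ φ x)
    (i : Fin 2) (j : Fin 3) :
    classicalPartial i φ x j = fderiv ℝ (fun y => φ y j) x (EuclideanSpace.single i 1) := by
  have := (EuclideanSpace.proj j : Space →L[ℝ] ℝ).hasFDerivAt.comp x hφ.hasFDerivAt
  have h2 := this.fderiv
  change fderiv ℝ (fun y => φ y j) x = _ at h2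
  rw [h2]
  rfl

namespace IsBubbleProfile

variable {c : ℝ → ℝ} {ρ : ℝ}

lemma contDiff_bubble (h : IsBubbleProfile c ρ) (x₀ : Plane) : ContDiff ℝ ∞ (bubble c x₀) := by
  have hc : ContDiff ℝ ∞ fun x => c (sqDist x₀ x) := h.contDiff.comp (contDiff_sqDist x₀)
  have hd : ContDiff ℝ ∞ fun x => c (sqDist x₀ x) ^ 2 + sqDist x₀ x :=
    (hc.pow 2).add (contDiff_sqDist x₀)
  have hne : ∀ x, c (sqDist x₀ x) ^ 2 + sqDist x₀ x ≠ 0 := fun x =>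
    (h.denom_pos (sqDist_nonneg x₀ x)).ne'
  have ha : ContDiff ℝ ∞ fun x => bubbleSlope c (sqDist x₀ x) :=
    (contDiff_const.mul hc).div hd hne
  have hk : ContDiff ℝ ∞ fun x => bubbleHeight c (sqDist x₀ x) :=
    (contDiff_const.mul (hc.pow 2)).div hd hne
  rw [contDiff_euclidean]
  intro i
  fin_cases i
  · exact ha.mul ((contDiff_coord 0).sub contDiff_const)
  · exact ha.mul ((contDiff_coord 1).sub contDiff_const)
  · exact hk

lemma bubble_eq_zero (h : IsBubbleProfile c ρ) {x₀ x : Plane} (hx : ρ ≤ ‖x - x₀‖) :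
    bubble c x₀ x = 0 := by
  have hc : c (sqDist x₀ x) = 0 := by
    refine h.eq_zero _ ?_
    rw [sqDist_eq]
    have := h.pos
    gcongr
  ext i
  fin_cases i <;> simp [bubble, bubbleSlope, bubbleHeight, hc]

lemma isTestFunction_bubble (h : IsBubbleProfile c ρ) {Ω : Set Plane} {x₀ : Plane}
    (hΩ : Metric.closedBall x₀ ρ ⊆ Ω) : IsTestFunction Ω (bubble c x₀) := by
  have hsub : tsupport (bubble c x₀) ⊆ Metric.closedBall x₀ ρ := by
    refine closure_minimal (fun x hx => ?_) Metric.isClosed_closedBall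
    rw [mem_closedBall_iff_norm]
    by_contra h'
    exact hx (h.bubble_eq_zero (not_le.1 h').le)
  exact ⟨h.contDiff_bubble x₀, (isCompact_closedBall x₀ ρ).of_isClosed_subset
    (isClosed_tsupport _) hsub, hsub.trans hΩ⟩

lemma norm_bubble_sub_e3 (h : IsBubbleProfile c ρ) (x₀ x : Plane) : ‖bubble c x₀ x - e3‖ = 1 := by
  have hD := h.denom_pos (sqDist_nonneg x₀ x)
  rw [← sq_eq_sq₀ (norm_nonneg _) zero_le_one, norm_sq_eq]
  simp only [bubble, bubbleSlope, bubbleHeight, e3_apply, PiLp.sub_apply]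
  simp
  have hs : sqDist x₀ x = (x 0 - x₀ 0) ^ 2 + (x 1 - x₀ 1) ^ 2 := rfl
  generalize c (sqDist x₀ x) = C at *
  rw [hs] at hD ⊢
  field_simp
  ring

/-- The partial derivatives of the skyrmion profile, in coordinates. -/
lemma classicalPartial_bubble (h : IsBubbleProfile c ρ) (x₀ x : Plane) :
    let s := sqDist x₀ x
    let y := x 0 - x₀ 0
    let z := x 1 - x₀ 1
    let a' := (2 * deriv c s * (s - c s ^ 2) - 2 * c s) / (c s ^ 2 + s) ^ 2
    let k' := (4 * c s * deriv c s * s - 2 * c s ^ 2) / (c s ^ 2 + s) ^ 2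
    classicalPartial 0 (bubble c x₀) x =
        !₂[bubbleSlope c s + 2 * a' * y ^ 2, 2 * a' * y * z, 2 * k' * y] ∧
      classicalPartial 1 (bubble c x₀) x =
        !₂[2 * a' * y * z, bubbleSlope c s + 2 * a' * z ^ 2, 2 * k' * z] := by
  intro s y z a' k'
  have hdiff : DifferentiableAt ℝ (bubble c x₀) x :=
    (h.contDiff_bubble x₀).differentiable (by simp) x
  have hs := hasFDerivAt_sqDist x₀ x
  have ha := (h.hasDerivAt_bubbleSlope (sqDist_nonneg x₀ x)).comp_hasFDerivAt x hs
  have hk := (h.hasDerivAt_bubbleHeight (sqDist_nonneg x₀ x)).comp_hasFDerivAt x hs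
  have h0 := (ha.fun_mul (hasFDerivAt_coord_sub x₀ x 0)).fderiv
  have h1 := (ha.fun_mul (hasFDerivAt_coord_sub x₀ x 1)).fderiv
  have h2 := hk.fderiv
  constructor <;> ext j <;> rw [classicalPartial_apply hdiff] <;> fin_cases j
  · refine (congrArg (fun L : Plane →L[ℝ] ℝ => L (EuclideanSpace.single 0 1)) h0).trans ?_
    simp [s, y, a']; ring
  · refine (congrArg (fun L : Plane →L[ℝ] ℝ => L (EuclideanSpace.single 0 1)) h1).trans ?_
    simp [s, y, z, a']; ring
  · refine (congrArg (fun L : Plane →L[ℝ] ℝ => L (EuclideanSpace.single 0 1)) h2).trans ?_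
    simp [s, y, k']; ring
  · refine (congrArg (fun L : Plane →L[ℝ] ℝ => L (EuclideanSpace.single 1 1)) h0).trans ?_
    simp [s, y, z, a']; ring
  · refine (congrArg (fun L : Plane →L[ℝ] ℝ => L (EuclideanSpace.single 1 1)) h1).trans ?_
    simp [s, z, a']; ring
  · refine (congrArg (fun L : Plane →L[ℝ] ℝ => L (EuclideanSpace.single 1 1)) h2).trans ?_
    simp [s, z, k']; ring

/-- The degree density of the skyrmion profile is `-2` times the derivative of the third component
with respect to the squared distance to the center. -/
lemma degreeDensity_bubble (h : IsBubbleProfile c ρ) (x₀ x : Plane) :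
    degreeDensity (bubble c x₀ x - e3) (classicalPartial 0 (bubble c x₀) x)
      (classicalPartial 1 (bubble c x₀) x) = -2 * deriv (bubbleHeight c) (sqDist x₀ x) := by
  obtain ⟨h0, h1⟩ := h.classicalPartial_bubble x₀ x
  have hD := h.denom_pos (sqDist_nonneg x₀ x)
  rw [(h.hasDerivAt_bubbleHeight (sqDist_nonneg x₀ x)).deriv, h0, h1, degreeDensity_eq]
  simp only [bubble, bubbleSlope, bubbleHeight, e3_apply, PiLp.sub_apply]
  simp
  have hs : sqDist x₀ x = (x 0 - x₀ 0) ^ 2 + (x 1 - x₀ 1) ^ 2 := rfl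
  generalize c (sqDist x₀ x) = C at *
  generalize deriv c (sqDist x₀ x) = C' at *
  rw [hs] at hD ⊢
  generalize x 0 - x₀ 0 = y at *
  generalize x 1 - x₀ 1 = z at *
  field_simp
  ring

/-- The Dirichlet density of the skyrmion profile is twice its degree density, up to an error caused
by the truncation. -/
lemma dirichlet_bubble (h : IsBubbleProfile c ρ) (x₀ x : Plane) :
    ‖classicalPartial 0 (bubble c x₀) x‖ ^ 2 + ‖classicalPartial 1 (bubble c x₀) x‖ ^ 2 =
      2 * degreeDensity (bubble c x₀ x - e3) (classicalPartial 0 (bubble c x₀) x)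
        (classicalPartial 1 (bubble c x₀) x) +
      16 * deriv c (sqDist x₀ x) ^ 2 *
        (sqDist x₀ x / (c (sqDist x₀ x) ^ 2 + sqDist x₀ x)) ^ 2 := by
  rw [h.degreeDensity_bubble]
  obtain ⟨h0, h1⟩ := h.classicalPartial_bubble x₀ x
  have hD := h.denom_pos (sqDist_nonneg x₀ x)
  rw [(h.hasDerivAt_bubbleHeight (sqDist_nonneg x₀ x)).deriv, h0, h1, norm_sq_eq, norm_sq_eq]
  simp only [bubbleSlope]
  simp
  have hs : sqDist x₀ x = (x 0 - x₀ 0) ^ 2 + (x 1 - x₀ 1) ^ 2 := rfl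
  generalize c (sqDist x₀ x) = C at *
  generalize deriv c (sqDist x₀ x) = C' at *
  rw [hs] at hD ⊢
  generalize x 0 - x₀ 0 = y at *
  generalize x 1 - x₀ 1 = z at *
  field_simp
  ring

lemma integral_degreeDensity_bubble (h : IsBubbleProfile c ρ) (x₀ : Plane) :
    ∫ x, degreeDensity (bubble c x₀ x - e3) (classicalPartial 0 (bubble c x₀) x)
      (classicalPartial 1 (bubble c x₀) x) = 4 * Real.pi := by
  have hpos : ∀ r : ℝ, c (r ^ 2) ^ 2 + r ^ 2 ≠ 0 := fun r => (h.denom_pos (sq_nonneg r)).ne'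
  have hcont : ContDiff ℝ 1 fun r : ℝ => bubbleHeight c (r ^ 2) := by
    have hc : ContDiff ℝ 1 fun r : ℝ => c (r ^ 2) :=
      (h.contDiff.of_le (by norm_num)).comp (contDiff_id.pow 2)
    exact (contDiff_const.mul (hc.pow 2)).div ((hc.pow 2).add (contDiff_id.pow 2)) hpos
  have hsupp : HasCompactSupport fun r : ℝ => bubbleHeight c (r ^ 2) := by
    refine HasCompactSupport.intro (isCompact_Icc (a := -ρ) (b := ρ)) fun r hr => ?_
    have : ρ ^ 2 ≤ r ^ 2 := by
      rw [sq_le_sq, abs_of_pos h.pos]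
      by_contra h'
      exact hr (abs_le.1 (not_le.1 h').le)
    simp [bubbleHeight, h.eq_zero _ this]
  have hderiv : ∀ r : ℝ, deriv (fun r : ℝ => bubbleHeight c (r ^ 2)) r =
      2 * r * deriv (bubbleHeight c) (r ^ 2) := by
    intro r
    have h1 := h.hasDerivAt_bubbleHeight (sq_nonneg r)
    have h2 := HasDerivAt.comp (h₂ := bubbleHeight c) (h := fun r : ℝ => r ^ 2) r h1
      (hasDerivAt_pow 2 r)
    rw [h1.deriv]
    refine h2.deriv.trans ?_
    push_cast
    ring
  have hball : volume.real (Metric.ball (0 : Plane) 1) = Real.pi := by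
    rw [Measure.real, EuclideanSpace.volume_ball_fin_two]
    simp [Real.pi_pos.le]
  simp_rw [h.degreeDensity_bubble, sqDist_eq]
  rw [integral_sub_right_eq_self (fun x : Plane => -2 * deriv (bubbleHeight c) (‖x‖ ^ 2)) x₀,
    integral_fun_norm_addHaar volume (fun r : ℝ => -2 * deriv (bubbleHeight c) (r ^ 2)), hball]
  have e : ∀ r : ℝ, r ^ (Module.finrank ℝ Plane - 1) • (-2 * deriv (bubbleHeight c) (r ^ 2)) =
      - deriv (fun r : ℝ => bubbleHeight c (r ^ 2)) r := by
    intro r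
    rw [hderiv]
    simp
    ring
  simp_rw [e]
  rw [integral_neg, hsupp.integral_Ioi_deriv_eq hcont]
  simp [bubbleHeight, h.ne_zero]
  ring

end IsBubbleProfile

end Bubble

/-! ### Integrability and the energy of a skyrmion -/

section Integrability

lemma continuous_energyDensity (κ Q : ℝ) :
    Continuous fun q : Space × Space × Space => energyDensity κ Q q.1 q.2.1 q.2.2 := by
  unfold energyDensity
  fun_prop

lemma continuous_degreeDensity :
    Continuous fun q : Space × Space × Space => degreeDensity q.1 q.2.1 q.2.2 := by
  simp only [degreeDensity_eq]
  fun_prop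

variable {f : Plane → Space} {g : Fin 2 → Plane → Space}

lemma integrable_energyDensity (κ Q : ℝ) (hf : MemLp f 2 volume)
    (hg : ∀ i, MemLp (g i) 2 volume) :
    Integrable fun x => energyDensity κ Q (f x) (g 0 x) (g 1 x) := by
  have hsq : ∀ {u : Plane → Space}, MemLp u 2 volume → Integrable fun x => ‖u x‖ ^ 2 := fun hu =>
    (memLp_two_iff_integrable_sq_norm hu.1).1 hu
  have hb : Integrable fun x =>
      (1 + 2 * |κ| + |Q - 1|) * (‖f x‖ ^ 2 + ‖g 0 x‖ ^ 2 + ‖g 1 x‖ ^ 2) :=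
    (((hsq hf).add (hsq (hg 0))).add (hsq (hg 1))).const_mul _
  have hm : AEStronglyMeasurable (fun x => energyDensity κ Q (f x) (g 0 x) (g 1 x)) volume :=
    Continuous.comp_aestronglyMeasurable
      (g := fun q : Space × Space × Space => energyDensity κ Q q.1 q.2.1 q.2.2)
      (f := fun x => (f x, g 0 x, g 1 x)) (continuous_energyDensity κ Q)
      (hf.1.prodMk ((hg 0).1.prodMk (hg 1).1))
  refine hb.mono' hm (Eventually.of_forall fun x => ?_)
  rw [Real.norm_eq_abs]
  exact abs_energyDensity_le κ Q (f x) (g 0 x) (g 1 x)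

lemma integrable_degreeDensity (hf : MemLp f 2 volume) (hg : ∀ i, MemLp (g i) 2 volume)
    (h1 : ∀ᵐ x, ‖f x - e3‖ = 1) :
    Integrable fun x => degreeDensity (f x - e3) (g 0 x) (g 1 x) := by
  have hsq : ∀ {u : Plane → Space}, MemLp u 2 volume → Integrable fun x => ‖u x‖ ^ 2 := fun hu =>
    (memLp_two_iff_integrable_sq_norm hu.1).1 hu
  refine Integrable.mono' (((hsq (hg 0)).add (hsq (hg 1))).const_mul 3)
    (continuous_degreeDensity.comp_aestronglyMeasurable
      ((hf.1.sub aestronglyMeasurable_const).prodMk ((hg 0).1.prodMk (hg 1).1))) ?_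
  filter_upwards [h1] with x hx
  have := abs_degreeDensity_le (f x - e3) (g 0 x) (g 1 x)
  rwa [hx, mul_one] at this

end Integrability

section BubbleEnergy

lemma IsBubbleProfile.energyDensity_bubble_le {c : ℝ → ℝ} {ρ : ℝ} (h : IsBubbleProfile c ρ)
    (κ Q : ℝ) {τ m : ℝ} (hτ : 0 < τ) (hm : ∀ s ∈ Set.Icc 0 (ρ ^ 2), |deriv c s| ≤ m)
    (x₀ x : Plane) :
    energyDensity κ Q (bubble c x₀ x) (classicalPartial 0 (bubble c x₀) x)
        (classicalPartial 1 (bubble c x₀) x) ≤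
      (1 + τ) * (2 * degreeDensity (bubble c x₀ x - e3) (classicalPartial 0 (bubble c x₀) x)
        (classicalPartial 1 (bubble c x₀) x)) +
      (Metric.closedBall x₀ ρ).indicator
        (fun _ => (1 + τ) * (16 * m ^ 2) + (κ ^ 2 / τ + |Q - 1|)) x := by
  by_cases hx : x ∈ Metric.closedBall x₀ ρ
  · rw [Set.indicator_of_mem hx]
    have hs : sqDist x₀ x ∈ Set.Icc 0 (ρ ^ 2) := by
      refine ⟨sqDist_nonneg _ _, ?_⟩
      rw [sqDist_eq]
      have := mem_closedBall_iff_norm.1 hx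
      gcongr
    have hD := h.denom_pos hs.1
    have herr : 16 * deriv c (sqDist x₀ x) ^ 2 *
        (sqDist x₀ x / (c (sqDist x₀ x) ^ 2 + sqDist x₀ x)) ^ 2 ≤ 16 * m ^ 2 := by
      have h1 : deriv c (sqDist x₀ x) ^ 2 ≤ m ^ 2 := sq_le_sq' (abs_le.1 (hm _ hs)).1
        (abs_le.1 (hm _ hs)).2
      have h2 : (sqDist x₀ x / (c (sqDist x₀ x) ^ 2 + sqDist x₀ x)) ^ 2 ≤ 1 := by
        rw [sq_le_one_iff_abs_le_one, abs_of_nonneg (div_nonneg hs.1 hD.le), div_le_one hD]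
        linarith [sq_nonneg (c (sqDist x₀ x))]
      calc _ ≤ 16 * m ^ 2 * 1 := by gcongr
        _ = _ := mul_one _
    have hdir := h.dirichlet_bubble x₀ x
    have hhor : bubble c x₀ x 0 ^ 2 + bubble c x₀ x 1 ^ 2 ≤ 1 := by
      have h1 := norm_sq_eq (bubble c x₀ x - e3)
      rw [h.norm_bubble_sub_e3] at h1
      simp only [PiLp.sub_apply, e3_apply] at h1
      simp at h1
      nlinarith [sq_nonneg (bubble c x₀ x 2 - 1)]
    set p := bubble c x₀ x
    set a := classicalPartial 0 (bubble c x₀) x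
    set b := classicalPartial 1 (bubble c x₀) x
    set d := degreeDensity (p - e3) a b
    have ha : a 2 ^ 2 ≤ ‖a‖ ^ 2 := by nlinarith [norm_sq_eq a, sq_nonneg (a 0), sq_nonneg (a 1)]
    have hb : b 2 ^ 2 ≤ ‖b‖ ^ 2 := by nlinarith [norm_sq_eq b, sq_nonneg (b 0), sq_nonneg (b 1)]
    -- Young's inequality for the two products in the mixed term.
    have young : ∀ q r : ℝ, -(2 * κ * (q * r)) ≤ τ * r ^ 2 + κ ^ 2 / τ * q ^ 2 := by
      intro q r
      have : τ * r ^ 2 + κ ^ 2 / τ * q ^ 2 + 2 * κ * (q * r) = (τ * r + κ * q) ^ 2 / τ := by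
        field_simp
        ring
      have : 0 ≤ (τ * r + κ * q) ^ 2 / τ := by positivity
      linarith
    have y0 := young (p 0) (a 2)
    have y1 := young (p 1) (b 2)
    have hQ : (Q - 1) * (p 0 ^ 2 + p 1 ^ 2) ≤ |Q - 1| * 1 :=
      mul_le_mul (le_abs_self _) hhor (by positivity) (abs_nonneg _)
    have hκ : κ ^ 2 / τ * (p 0 ^ 2 + p 1 ^ 2) ≤ κ ^ 2 / τ * 1 := by gcongr
    have hgrad : (1 + τ) * (‖a‖ ^ 2 + ‖b‖ ^ 2) ≤ (1 + τ) * (2 * d + 16 * m ^ 2) := by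
      rw [hdir]
      gcongr
    have hta : τ * a 2 ^ 2 ≤ τ * ‖a‖ ^ 2 := by gcongr
    have htb : τ * b 2 ^ 2 ≤ τ * ‖b‖ ^ 2 := by gcongr
    rw [energyDensity]
    linarith
  · have ht := h.isTestFunction_bubble (x₀ := x₀) subset_rfl
    simp [hx, ht.eq_zero hx, (ht.classicalPartial _).eq_zero hx]

lemma IsBubbleProfile.integral_energyDensity_bubble_le {c : ℝ → ℝ} {ρ : ℝ}
    (h : IsBubbleProfile c ρ) (κ Q : ℝ) {τ m : ℝ} (hτ : 0 < τ)
    (hm : ∀ s ∈ Set.Icc 0 (ρ ^ 2), |deriv c s| ≤ m) (x₀ : Plane) :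
    ∫ x, energyDensity κ Q (bubble c x₀ x) (classicalPartial 0 (bubble c x₀) x)
        (classicalPartial 1 (bubble c x₀) x) ≤
      (1 + τ) * (8 * Real.pi) +
        ((1 + τ) * (16 * m ^ 2) + (κ ^ 2 / τ + |Q - 1|)) * (Real.pi * ρ ^ 2) := by
  have ht := h.isTestFunction_bubble (x₀ := x₀) subset_rfl
  have hvol : volume.real (Metric.closedBall x₀ ρ) = Real.pi * ρ ^ 2 := by
    rw [Measure.real, EuclideanSpace.volume_closedBall_fin_two]
    simp [Real.pi_pos.le, h.pos.le, mul_comm]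
  have hdeg : Integrable fun x => degreeDensity (bubble c x₀ x - e3)
      (classicalPartial 0 (bubble c x₀) x) (classicalPartial 1 (bubble c x₀) x) :=
    integrable_degreeDensity (g := fun i => classicalPartial i (bubble c x₀)) ht.memLp
      (fun i => (ht.classicalPartial i).memLp) (Eventually.of_forall (h.norm_bubble_sub_e3 x₀))
  have hind : Integrable ((Metric.closedBall x₀ ρ).indicator
      (fun _ => (1 + τ) * (16 * m ^ 2) + (κ ^ 2 / τ + |Q - 1|))) volume :=
    (integrable_indicator_iff measurableSet_closedBall).2
      (integrableOn_const (measure_closedBall_lt_top).ne)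
  refine (integral_mono (integrable_energyDensity κ Q
    (g := fun i => classicalPartial i (bubble c x₀)) ht.memLp
    (fun i => (ht.classicalPartial i).memLp)) (((hdeg.const_mul 2).const_mul (1 + τ)).add hind)
    (h.energyDensity_bubble_le κ Q hτ hm x₀)).trans_eq ?_
  simp only [Pi.add_apply]
  rw [integral_add ((hdeg.const_mul 2).const_mul (1 + τ)) hind, integral_const_mul,
    integral_const_mul, h.integral_degreeDensity_bubble, integral_indicator measurableSet_closedBall,
    setIntegral_const, hvol, smul_eq_mul]
  ring

/-- On small balls there are truncated skyrmions whose energy is arbitrarily close to `8π`. -/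
lemma exists_isBubbleProfile (κ Q : ℝ) {ε : ℝ} (hε : 0 < ε) :
    ∃ ρ₀ : ℝ, 0 < ρ₀ ∧ ∀ ρ : ℝ, 0 < ρ → ρ ≤ ρ₀ → ∃ c : ℝ → ℝ, IsBubbleProfile c ρ ∧
      ∀ x₀ : Plane, ∫ x, energyDensity κ Q (bubble c x₀ x) (classicalPartial 0 (bubble c x₀) x)
        (classicalPartial 1 (bubble c x₀) x) ≤ 8 * Real.pi + ε := by
  have hπ := Real.pi_pos
  -- Each of the three error terms gets `ε / 3`: the weight `τ` in Young's inequality is chosen first,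
  -- then the radius `ρ` (small compared with `κ² / τ`), then the scale `μ` of the profile.
  set τ := ε / (24 * Real.pi) with hτ
  have hτ0 : 0 < τ := by positivity
  have hτε : τ * (8 * Real.pi) = ε / 3 := by rw [hτ]; field_simp; norm_num
  set L := κ ^ 2 / τ + |Q - 1| with hL
  have hL0 : 0 ≤ L := by positivity
  refine ⟨min 1 (ε / (3 * (Real.pi * (L + 1)))), by positivity, fun ρ hρ hρ₀ => ?_⟩
  have hρ1 : ρ ≤ 1 := hρ₀.trans (min_le_left _ _)
  have hLρ : L * (Real.pi * ρ ^ 2) ≤ ε / 3 := by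
    have h1 := (le_div_iff₀ (by positivity)).1 (hρ₀.trans (min_le_right _ _))
    calc L * (Real.pi * ρ ^ 2) ≤ (L + 1) * (Real.pi * (ρ * 1)) := by
          rw [sq]; gcongr; linarith
      _ ≤ ε / 3 := by linarith
  set χ : ℝ → ℝ := fun s => Real.smoothTransition (1 - s / ρ ^ 2) with hχ
  have hχs : ContDiff ℝ ∞ χ :=
    Real.smoothTransition.contDiff.comp (contDiff_const.sub (contDiff_id.div_const _))
  obtain ⟨M, hM⟩ := (isCompact_Icc (a := 0) (b := ρ ^ 2)).exists_bound_of_continuousOn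
    (hχs.continuous_deriv (by simp)).continuousOn
  set A := (1 + τ) * 16 * M ^ 2 * (Real.pi * ρ ^ 2) with hA
  have hA0 : 0 ≤ A := by positivity
  set μ := Real.sqrt (ε / (3 * (A + 1))) with hμ
  have hμ0 : 0 < μ := Real.sqrt_pos.2 (by positivity)
  have hμ2 : μ ^ 2 * A ≤ ε / 3 := by
    rw [hμ, Real.sq_sqrt (by positivity), div_mul_eq_mul_div, div_le_div_iff₀ (by positivity)
      (by norm_num)]
    nlinarith
  have hprof : IsBubbleProfile (fun s => μ * χ s) ρ :=
    { contDiff := contDiff_const.mul hχs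
      ne_zero := by simp [hχ, hμ0.ne']
      eq_zero := fun s hs => by
        have : 1 - s / ρ ^ 2 ≤ 0 := by
          rw [sub_nonpos, le_div_iff₀ (by positivity), one_mul]
          exact hs
        simp [hχ, Real.smoothTransition.zero_of_nonpos this]
      pos := hρ }
  refine ⟨_, hprof, fun x₀ => ?_⟩
  have hm : ∀ s ∈ Set.Icc 0 (ρ ^ 2), |deriv (fun s => μ * χ s) s| ≤ μ * M := by
    intro s hs
    rw [deriv_const_mul _ (hχs.differentiable (by simp) s), abs_mul, abs_of_pos hμ0]
    gcongr
    exact hM s hs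
  refine (hprof.integral_energyDensity_bubble_le κ Q hτ0 hm x₀).trans ?_
  have e : ((1 + τ) * (16 * (μ * M) ^ 2) + L) * (Real.pi * ρ ^ 2) =
      μ ^ 2 * A + L * (Real.pi * ρ ^ 2) := by rw [hA]; ring
  rw [e]
  linarith

end BubbleEnergy

/-! ### Invariance under shifts, freeing a ball at the boundary, and gluing -/

section ShiftEnergy

variable {η : Plane → ℝ} {v : Plane} {δ : ℝ}

/-- The change of variables `IsSmallShift.integral_eq` preserves integrability. -/
lemma IsSmallShift.integrable {E : Type*} [NormedAddCommGroup E] [NormedSpace ℝ E]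
    (h : IsSmallShift η v δ) {u : Plane → E} (hu : Integrable u) :
    Integrable fun x => (1 - fderiv ℝ η x v) • u (shift η v x) := by
  have := integrableOn_image_iff_integrableOn_abs_det_fderiv_smul volume MeasurableSet.univ
    (fun x _ => (h.hasFDerivAt_shift x).hasFDerivWithinAt) h.bijective_shift.1.injOn u
  rw [Set.image_univ, h.bijective_shift.2.range_eq, integrableOn_univ, integrableOn_univ] at this
  refine (this.1 hu).congr (Eventually.of_forall fun x => ?_)
  have h1 := abs_le.1 (h.abs_fderiv_apply_le x)
  have h2 := h.le_half
  simp only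
  rw [IsSmallShift.det_fderiv_shift, abs_of_nonneg (by linarith)]

variable {f : Plane → Space} {g : Fin 2 → Plane → Space}

lemma degreeDensity_shiftGradient (g : Fin 2 → Plane → Space) (p : Space) (x : Plane) :
    degreeDensity p (shiftGradient η v g 0 x) (shiftGradient η v g 1 x) =
      (1 - fderiv ℝ η x v) * degreeDensity p (g 0 (shift η v x)) (g 1 (shift η v x)) := by
  rw [fderiv_apply_eq η x v]
  exact degreeDensity_sub_smul p _ _ (v 0) (v 1) _ _

/-- The degree is invariant under an orientation preserving diffeomorphism of the domain. -/
lemma integral_degreeDensity_shift (h : IsSmallShift η v δ) :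
    ∫ x, degreeDensity ((f ∘ shift η v) x - e3) (shiftGradient η v g 0 x)
      (shiftGradient η v g 1 x) = ∫ x, degreeDensity (f x - e3) (g 0 x) (g 1 x) := by
  rw [h.integral_eq fun x => degreeDensity (f x - e3) (g 0 x) (g 1 x)]
  simp only [degreeDensity_shiftGradient, smul_eq_mul, Function.comp_apply]

/-- The energy changes by `O(δ)` under a diffeomorphism that is `δ`-close to the identity. -/
lemma integral_energyDensity_shift_le (κ Q : ℝ) (h : IsSmallShift η v δ)
    (hf : MemLp f 2 volume) (hg : ∀ i, MemLp (g i) 2 volume) :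
    ∫ x, energyDensity κ Q ((f ∘ shift η v) x) (shiftGradient η v g 0 x)
        (shiftGradient η v g 1 x) ≤
      (∫ x, energyDensity κ Q (f x) (g 0 x) (g 1 x)) +
        δ * (2 * (13 + 10 * |κ| + |Q - 1|) *
          ∫ x, (‖f x‖ ^ 2 + ‖g 0 x‖ ^ 2 + ‖g 1 x‖ ^ 2)) := by
  have hsq : ∀ {u : Plane → Space}, MemLp u 2 volume → Integrable fun x => ‖u x‖ ^ 2 := fun hu =>
    (memLp_two_iff_integrable_sq_norm hu.1).1 hu
  have hR : Integrable fun x => ‖f x‖ ^ 2 + ‖g 0 x‖ ^ 2 + ‖g 1 x‖ ^ 2 :=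
    ((hsq hf).add (hsq (hg 0))).add (hsq (hg 1))
  have hE := integrable_energyDensity κ Q hf hg
  have hE' := integrable_energyDensity κ Q (h.memLp_comp hf) (memLp_shiftGradient h hg)
  rw [h.integral_eq fun x => energyDensity κ Q (f x) (g 0 x) (g 1 x),
    h.integral_eq fun x => ‖f x‖ ^ 2 + ‖g 0 x‖ ^ 2 + ‖g 1 x‖ ^ 2, ← mul_assoc,
    ← integral_const_mul, ← integral_add (h.integrable hE) ((h.integrable hR).const_mul _)]
  refine integral_mono hE' ((h.integrable hE).add ((h.integrable hR).const_mul _)) fun x => ?_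
  simp only [smul_eq_mul, Function.comp_apply]
  have hdet := h.abs_fderiv_apply_le x
  have h1 := abs_energyDensity_sub_smul_le κ Q (f (shift η v x)) (g 0 (shift η v x))
    (g 1 (shift η v x)) (h.abs_coord_le 0) (h.abs_coord_le 1) (h.abs_classicalPartial_le 0 x)
    (h.abs_classicalPartial_le 1 x) (D := 1 - fderiv ℝ η x v) (by rwa [sub_sub_cancel])
    (h.le_half.trans (by norm_num))
  have h2 := (abs_le.1 h1).2
  have h3 : (1 : ℝ) ≤ 2 * (1 - fderiv ℝ η x v) := by
    have := (abs_le.1 hdet).2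
    linarith [h.le_half]
  set R := ‖f (shift η v x)‖ ^ 2 + ‖g 0 (shift η v x)‖ ^ 2 + ‖g 1 (shift η v x)‖ ^ 2 with hRdef
  -- As the Jacobian is at least `1 / 2`, the error is at most twice an integrand to which the change
  -- of variables applies.
  have h4 : 0 ≤ (13 + 10 * |κ| + |Q - 1|) * δ * R := by
    have := h.nonneg
    positivity
  have h5 := mul_le_mul_of_nonneg_left h3 h4
  change energyDensity κ Q (f (shift η v x))
    (g 0 (shift η v x) - classicalPartial 0 η x • (v 0 • g 0 (shift η v x) +
      v 1 • g 1 (shift η v x))) (g 1 (shift η v x) - classicalPartial 1 η x •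
      (v 0 • g 0 (shift η v x) + v 1 • g 1 (shift η v x))) ≤ _
  linarith

end ShiftEnergy

section Boundary

/-- Near a boundary point, a domain with Lipschitz boundary is the positivity set of a continuous
function `G`, the height above the graph, which drops by `c` under the translation by `-c • v`. -/
lemma HasLipschitzBoundary.exists_height {Ω : Set Plane} (hΩ : HasLipschitzBoundary Ω)
    (hΩo : IsOpen Ω) {x₀ : Plane} (hx₀ : x₀ ∈ frontier Ω) :
    ∃ (G : Plane → ℝ) (v : Plane) (r : ℝ), 0 < r ∧ Continuous G ∧ ‖v‖ = 1 ∧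
      (∀ (y : Plane) (c : ℝ), G (y - c • v) = G y - c) ∧
      (∀ y ∈ Metric.ball x₀ r, (y ∈ Ω ↔ 0 < G y)) ∧ G x₀ = 0 := by
  obtain ⟨Φ, γ, K, r, hγ, hr, hgraph⟩ := hΩ x₀ hx₀
  have hΦ : ∀ (y : Plane) (c : ℝ),
      Φ (y - c • Φ.linearIsometryEquiv.symm (EuclideanSpace.single 1 1)) =
        Φ y - c • EuclideanSpace.single 1 1 := by
    intro y c
    have := Φ.map_vadd y (-(c • Φ.linearIsometryEquiv.symm (EuclideanSpace.single 1 1)))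
    simp only [vadd_eq_add, map_neg, map_smul, LinearIsometryEquiv.apply_symm_apply] at this
    rw [sub_eq_neg_add, sub_eq_neg_add, ← this]
  have hGc : Continuous fun y => Φ y 1 - γ (Φ y 0) := by
    have h0 : ∀ i, Continuous fun y => Φ y i := fun i =>
      (EuclideanSpace.proj i : Plane →L[ℝ] ℝ).continuous.comp Φ.continuous
    exact (h0 1).sub (hγ.continuous.comp (h0 0))
  have hmem : ∀ y ∈ Metric.ball x₀ r, (y ∈ Ω ↔ 0 < Φ y 1 - γ (Φ y 0)) := fun y hy =>
    (hgraph y hy).trans sub_pos.symm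
  refine ⟨fun y => Φ y 1 - γ (Φ y 0), Φ.linearIsometryEquiv.symm (EuclideanSpace.single 1 1), r, hr,
    hGc, by simp, fun y c => ?_, hmem, ?_⟩
  · simp only [hΦ]
    simp
    ring
  · rw [hΩo.frontier_eq] at hx₀
    refine le_antisymm (not_lt.1 fun h => hx₀.2 ((hmem _ (Metric.mem_ball_self hr)).2 h))
      (not_lt.1 fun h => ?_)
    have hnhds : Metric.ball x₀ r ∩ {y | Φ y 1 - γ (Φ y 0) < 0} ∈ 𝓝 x₀ :=
      inter_mem (Metric.ball_mem_nhds x₀ hr) ((isOpen_lt hGc continuous_const).mem_nhds h)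
    obtain ⟨y, hy, hyΩ⟩ := mem_closure_iff_nhds.1 hx₀.1 _ hnhds
    exact lt_asymm ((hmem y hy.1).1 hyΩ) hy.2

/-- A bump function of small height `t`, centered at `x₀`, defines a small shift. -/
lemma exists_isSmallShift_bump {v : Plane} (hv : ‖v‖ = 1) (x₀ : Plane) {r δ : ℝ} (hr : 0 < r)
    (hδ : 0 < δ) (hδ' : δ ≤ 1 / 2) :
    ∃ (η : Plane → ℝ) (t : ℝ), IsSmallShift η v δ ∧ 0 < t ∧ t ≤ r / 4 ∧
      (∀ x, 0 ≤ η x ∧ η x ≤ t) ∧ (∀ x ∈ Metric.closedBall x₀ (r / 4), η x = t) ∧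
      ∀ x ∉ Metric.ball x₀ (r / 2), η x = 0 := by
  let b : ContDiffBump x₀ := ⟨r / 4, r / 2, by positivity, by linarith⟩
  have hb : ContDiff ℝ ∞ b := b.contDiff
  obtain ⟨M, hM⟩ := (hb.continuous_fderiv (by simp)).bounded_above_of_compact_support
    (b.hasCompactSupport.fderiv ℝ)
  have hM0 : 0 ≤ M := (norm_nonneg _).trans (hM 0)
  obtain ⟨t, ht0, htr, htδ⟩ : ∃ t : ℝ, 0 < t ∧ t ≤ r / 4 ∧ t ≤ δ / (M + 1) :=
    ⟨min (r / 4) (δ / (M + 1)), by positivity, min_le_left _ _, min_le_right _ _⟩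
  have htM : t * M ≤ δ := by
    calc t * M ≤ δ / (M + 1) * (M + 1) := by
          gcongr
          linarith
      _ = δ := by field_simp
  refine ⟨fun x => t * b x, t, ?_, ht0, htr,
    fun x => ⟨mul_nonneg ht0.le b.nonneg, mul_le_of_le_one_right ht0.le b.le_one⟩,
    fun x hx => (congrArg (t * ·) (b.one_of_mem_closedBall hx)).trans (mul_one t),
    fun x hx => (congrArg (t * ·) (b.zero_of_le_dist (not_lt.1 hx))).trans (mul_zero t)⟩
  exact
    { contDiff := contDiff_const.mul hb
      hasCompactSupport := b.hasCompactSupport.mul_left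
      norm_fderiv_le := fun x => by
        rw [fderiv_const_mul (hb.differentiable (by simp) x), norm_smul, Real.norm_eq_abs,
          abs_of_pos ht0]
        exact (mul_le_mul_of_nonneg_left (hM x) ht0.le).trans htM
      le_half := hδ'
      norm_le := hv.le }

/-- A domain with Lipschitz boundary can be pushed into itself, near a boundary point, by a
diffeomorphism arbitrarily close to the identity, so that a small ball in the domain is freed. -/
lemma IsBoundedLipschitzDomain.exists_shift {Ω : Set Plane} (hΩ : IsBoundedLipschitzDomain Ω)
    {δ : ℝ} (hδ : 0 < δ) (hδ' : δ ≤ 1 / 2) :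
    ∃ (η : Plane → ℝ) (v : Plane), IsSmallShift η v δ ∧ shift η v ⁻¹' Ω ⊆ Ω ∧
      ∃ (x₁ : Plane) (r : ℝ), 0 < r ∧
        ∀ x ∈ Metric.closedBall x₁ r, x ∈ Ω ∧ shift η v x ∉ Ω := by
  have hne : (frontier Ω).Nonempty := by
    refine nonempty_frontier_iff.2 ⟨hΩ.isConnected.nonempty, fun h => ?_⟩
    exact NormedSpace.unbounded_univ ℝ Plane (h ▸ hΩ.isBounded)
  obtain ⟨x₀, hx₀⟩ := hne
  obtain ⟨G, v, r, hr, hGc, hvn, hGv, hmem, hG0⟩ := hΩ.lipschitz.exists_height hΩ.isOpen hx₀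
  obtain ⟨η, t, hS, ht0, htr, hη, hηt, hη0⟩ := exists_isSmallShift_bump hvn x₀ hr hδ hδ'
  have hnorm : ∀ c : ℝ, 0 ≤ c → ‖c • v‖ = c := fun c hc => by
    rw [norm_smul, hvn, mul_one, Real.norm_eq_abs, abs_of_nonneg hc]
  refine ⟨η, v, hS, fun x hx => ?_, x₀ + (t / 2) • v, ?_⟩
  · rw [Set.mem_preimage] at hx
    by_cases hxb : x ∈ Metric.ball x₀ (r / 2)
    · have hxr : x ∈ Metric.ball x₀ r := Metric.ball_subset_ball (by linarith) hxb
      have hsr : shift η v x ∈ Metric.ball x₀ r := by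
        rw [Metric.mem_ball] at hxb ⊢
        have : dist (shift η v x) x ≤ t := by
          rw [dist_eq_norm, shift, sub_sub_cancel_left, norm_neg, hnorm _ (hη x).1]
          exact (hη x).2
        linarith [dist_triangle (shift η v x) x x₀]
      have h1 := (hmem _ hsr).1 hx
      rw [shift, hGv] at h1
      exact (hmem x hxr).2 (by linarith [(hη x).1])
    · rw [shift, hη0 x hxb, zero_smul, sub_zero] at hx
      exact hx
  · have hd : dist (x₀ + (t / 2) • v) x₀ = t / 2 := by
      rw [dist_eq_norm, add_sub_cancel_left, hnorm _ (by positivity)]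
    have hη1 : η (x₀ + (t / 2) • v) = t := hηt _ (by rw [Metric.mem_closedBall, hd]; linarith)
    have e1 : x₀ + (t / 2) • v = x₀ - (-(t / 2)) • v := by rw [neg_smul, sub_neg_eq_add]
    have e2 : shift η v (x₀ + (t / 2) • v) = x₀ - (t / 2) • v := by
      rw [shift, hη1]
      module
    have hG1 : 0 < G (x₀ + (t / 2) • v) := by rw [e1, hGv, hG0]; linarith
    have hG2 : G (shift η v (x₀ + (t / 2) • v)) < 0 := by rw [e2, hGv, hG0]; linarith
    have hb1 : x₀ + (t / 2) • v ∈ Metric.ball x₀ r := by rw [Metric.mem_ball, hd]; linarith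
    have hb2 : shift η v (x₀ + (t / 2) • v) ∈ Metric.ball x₀ r := by
      rw [e2, mem_ball_iff_norm, sub_sub_cancel_left, norm_neg, hnorm _ (by positivity)]
      linarith
    have hc := hS.continuous_shift
    have hnhds : ∀ᶠ x in 𝓝 (x₀ + (t / 2) • v), x ∈ Ω ∧ shift η v x ∉ Ω := by
      filter_upwards [hGc.continuousAt.eventually (lt_mem_nhds hG1),
        (hGc.comp hc).continuousAt.eventually (gt_mem_nhds hG2), Metric.isOpen_ball.mem_nhds hb1,
        hc.continuousAt.eventually (Metric.isOpen_ball.mem_nhds hb2)] with x h1 h2 h3 h4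
      exact ⟨(hmem x h3).2 h1, fun h => lt_asymm ((hmem _ h4).1 h) h2⟩
    obtain ⟨s, hs, hsub⟩ := Metric.nhds_basis_closedBall.eventually_iff.1 hnhds
    exact ⟨s, hs, fun x hx => hsub hx⟩

end Boundary

section Admissible

variable {Ω : Set Plane}

/-- An admissible map, extended by `-e₃` to the whole plane, as an element of `H¹₀(Ω)`. -/
lemma exists_isH10Pair_of_mem_admissible (hΩ : IsOpen Ω) (κ Q : ℝ) {d : ℤ} {m : Plane → Space}
    (hm : m ∈ admissible Ω d) :
    ∃ (f : Plane → Space) (g : Fin 2 → Plane → Space), IsH10Pair Ω f g ∧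
      (∀ᵐ x, ‖f x - e3‖ = 1) ∧
      ∫ x, degreeDensity (f x - e3) (g 0 x) (g 1 x) = 4 * Real.pi * d ∧
      ∫ x, energyDensity κ Q (f x) (g 0 x) (g 1 x) = energy Ω κ Q m := by
  obtain ⟨hm1, hm2, hm3, hm4⟩ := hm
  have hpair := hm3.isH10Pair hΩ
  have hwp : ∀ i, weakPartial Ω i m =ᵐ[volume.restrict Ω] weakPartial Ω i fun x => m x + e3 := by
    intro i
    obtain ⟨g, hg, -⟩ := hm1.2 i
    exact (hg.weakPartial_ae_eq hΩ).trans ((hg.add_const e3).weakPartial_ae_eq hΩ).symm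
  refine ⟨_, _, hpair, ?_, ?_, ?_⟩
  · filter_upwards [(ae_restrict_iff' hΩ.measurableSet).1 hm2] with x hx
    by_cases hxΩ : x ∈ Ω
    · simp [hxΩ, hx hxΩ]
    · simp [hxΩ]
  · rw [← setIntegral_eq_integral_of_forall_compl_eq_zero (s := Ω) fun x hx => by simp [hx]]
    have hdeg : ∫ x in Ω, degreeDensity (m x) (weakPartial Ω 0 m x) (weakPartial Ω 1 m x) =
        4 * Real.pi * d := by
      have hπ := Real.pi_pos
      rw [← hm4, degree]
      simp only [degreeDensity]
      field_simp
    rw [← hdeg]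
    refine integral_congr_ae ?_
    filter_upwards [hwp 0, hwp 1, ae_restrict_mem hΩ.measurableSet] with x h0 h1 hx
    simp [hx, h0, h1]
  · rw [← setIntegral_eq_integral_of_forall_compl_eq_zero (s := Ω) fun x hx => by simp [hx]]
    refine integral_congr_ae ?_
    filter_upwards [hwp 0, hwp 1, ae_restrict_mem hΩ.measurableSet] with x h0 h1 hx
    simp only [Set.indicator_of_mem hx]
    rw [← energyDensity_sub_e3, add_sub_cancel_right, ← h0, ← h1]
    rfl

/-- Conversely, an element of `H¹₀(Ω)` such that `f - e₃` takes values in the sphere and has degree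
`d` gives an admissible map, and `g` computes its energy. -/
lemma IsH10Pair.mem_admissible (hΩ : IsBoundedLipschitzDomain Ω) (κ Q : ℝ) {d : ℤ}
    {f : Plane → Space} {g : Fin 2 → Plane → Space} (h : IsH10Pair Ω f g)
    (h1 : ∀ᵐ x, ‖f x - e3‖ = 1)
    (hdeg : ∫ x, degreeDensity (f x - e3) (g 0 x) (g 1 x) = 4 * Real.pi * d) :
    (fun x => f x - e3) ∈ admissible Ω d ∧
      energy Ω κ Q (fun x => f x - e3) = ∫ x, energyDensity κ Q (f x) (g 0 x) (g 1 x) := by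
  have hfin : IsFiniteMeasure (volume.restrict Ω) :=
    ⟨by rw [Measure.restrict_apply_univ]; exact hΩ.isBounded.measure_lt_top⟩
  have hw : ∀ i, IsWeakPartial Ω i (fun x => f x - e3) (g i) := fun i => by
    simpa only [sub_eq_add_neg] using (h.isWeakPartial i).add_const (-e3)
  have hwp := fun i => (hw i).weakPartial_ae_eq hΩ.isOpen
  refine ⟨⟨⟨(h.memLp.restrict Ω).sub (memLp_const e3), fun i =>
    ⟨g i, hw i, (h.memLp_partial i).restrict Ω⟩⟩, ae_restrict_of_ae h1, ?_, ?_⟩, ?_⟩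
  · simpa only [sub_add_cancel] using h.memH10 hΩ.isOpen
  · have e : ∫ x in Ω, degreeDensity (f x - e3) (weakPartial Ω 0 (fun x => f x - e3) x)
        (weakPartial Ω 1 (fun x => f x - e3) x) = 4 * Real.pi * d := by
      rw [← hdeg]
      refine Eq.trans ?_ (setIntegral_eq_integral_of_forall_compl_eq_zero (s := Ω)
        fun x hx => by simp [h.partial_eq_zero _ x hx])
      refine integral_congr_ae ?_
      filter_upwards [hwp 0, hwp 1] with x h0 h1
      rw [h0, h1]
    have hπ := Real.pi_pos
    simp only [degreeDensity] at e
    rw [degree, e]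
    field_simp
  · rw [← setIntegral_eq_integral_of_forall_compl_eq_zero (s := Ω)
      fun x hx => by simp [h.partial_eq_zero _ x hx, h.eq_zero x hx]]
    refine integral_congr_ae ?_
    filter_upwards [hwp 0, hwp 1] with x h0 h1
    rw [← energyDensity_sub_e3, ← h0, ← h1]
    rfl

/-- Insertion of a skyrmion: up to an arbitrarily small error, the degree of an admissible map can
be raised by one at the cost `8π`. -/
lemma exists_mem_admissible_add_one (hΩ : IsBoundedLipschitzDomain Ω) (κ Q : ℝ) {d : ℤ}
    {m : Plane → Space} (hm : m ∈ admissible Ω d) {ε : ℝ} (hε : 0 < ε) :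
    ∃ m' ∈ admissible Ω (d + 1), energy Ω κ Q m' ≤ energy Ω κ Q m + 8 * Real.pi + ε := by
  obtain ⟨f, g, hfg, hnorm, hdeg, henergy⟩ :=
    exists_isH10Pair_of_mem_admissible hΩ.isOpen κ Q hm
  set C := 2 * (13 + 10 * |κ| + |Q - 1|) * ∫ x, (‖f x‖ ^ 2 + ‖g 0 x‖ ^ 2 + ‖g 1 x‖ ^ 2) with hC
  have hC0 : 0 ≤ C := mul_nonneg (by positivity) (integral_nonneg fun x => by positivity)
  set δ := min (1 / 2) (ε / (2 * (C + 1))) with hδ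
  have hδ0 : 0 < δ := by positivity
  have hδC : δ * C ≤ ε / 2 := by
    calc δ * C ≤ ε / (2 * (C + 1)) * (C + 1) := by
          gcongr
          · exact min_le_right _ _
          · linarith
      _ = ε / 2 := by field_simp
  obtain ⟨η, v, hS, hpre, x₁, r, hr, hball⟩ := hΩ.exists_shift hδ0 (min_le_left _ _)
  obtain ⟨ρ₀, hρ₀, hbub⟩ := exists_isBubbleProfile κ Q (half_pos hε)
  set ρ := min ρ₀ r with hρ
  obtain ⟨c, hc, hcE⟩ := hbub ρ (lt_min hρ₀ hr) (min_le_left _ _)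
  set B := Metric.closedBall x₁ ρ with hB
  have hBr : B ⊆ Metric.closedBall x₁ r := Metric.closedBall_subset_closedBall (min_le_right _ _)
  have ht : IsTestFunction B (bubble c x₁) := hc.isTestFunction_bubble subset_rfl
  have htΩ : IsTestFunction Ω (bubble c x₁) :=
    hc.isTestFunction_bubble fun x hx => (hball x (hBr hx)).1
  have hS1 := hfg.comp_shift hS hpre
  have hpair := hS1.add_testFunction htΩ
  have hzero : ∀ x ∈ B, (f ∘ shift η v) x = 0 ∧ ∀ i, shiftGradient η v g i x = 0 := by
    intro x hx
    have hx' := (hball x (hBr hx)).2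
    exact ⟨hfg.eq_zero _ hx', fun i => by simp [shiftGradient, hfg.partial_eq_zero _ _ hx']⟩
  have hnormS : ∀ᵐ x, ‖(f ∘ shift η v) x - e3‖ = 1 := hS.quasiMeasurePreserving.ae hnorm
  have hdegS := integrable_degreeDensity hS1.memLp hS1.memLp_partial hnormS
  have hdegB := integrable_degreeDensity (g := fun i => classicalPartial i (bubble c x₁)) ht.memLp
    (fun i => (ht.classicalPartial i).memLp) (Eventually.of_forall (hc.norm_bubble_sub_e3 x₁))
  have hES := integrable_energyDensity κ Q hS1.memLp hS1.memLp_partial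
  have hEB := integrable_energyDensity κ Q (g := fun i => classicalPartial i (bubble c x₁))
    ht.memLp (fun i => (ht.classicalPartial i).memLp)
  obtain ⟨hmem, hen⟩ := hpair.mem_admissible hΩ κ Q (d := d + 1) (by
      filter_upwards [hnormS] with x hx
      by_cases hxB : x ∈ B
      · simp [(hzero x hxB).1, hc.norm_bubble_sub_e3 x₁ x, -Function.comp_apply]
      · simpa [ht.eq_zero hxB] using hx) (by
      have e : ∀ x, degreeDensity ((f ∘ shift η v + bubble c x₁) x - e3)
          ((shiftGradient η v g 0 + classicalPartial 0 (bubble c x₁)) x)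
          ((shiftGradient η v g 1 + classicalPartial 1 (bubble c x₁)) x) =
          degreeDensity ((f ∘ shift η v) x - e3) (shiftGradient η v g 0 x)
            (shiftGradient η v g 1 x) +
          degreeDensity (bubble c x₁ x - e3) (classicalPartial 0 (bubble c x₁) x)
            (classicalPartial 1 (bubble c x₁) x) := by
        intro x
        by_cases hxB : x ∈ B
        · simp [hzero x hxB, -Function.comp_apply]
        · simp [ht.eq_zero hxB, (ht.classicalPartial _).eq_zero hxB]
      simp_rw [e]
      rw [integral_add hdegS hdegB, integral_degreeDensity_shift hS, hdeg,
        hc.integral_degreeDensity_bubble]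
      push_cast
      ring)
  refine ⟨_, hmem, ?_⟩
  have e : ∀ x, energyDensity κ Q ((f ∘ shift η v + bubble c x₁) x)
      ((shiftGradient η v g 0 + classicalPartial 0 (bubble c x₁)) x)
      ((shiftGradient η v g 1 + classicalPartial 1 (bubble c x₁)) x) =
      energyDensity κ Q ((f ∘ shift η v) x) (shiftGradient η v g 0 x)
        (shiftGradient η v g 1 x) +
      energyDensity κ Q (bubble c x₁ x) (classicalPartial 0 (bubble c x₁) x)
        (classicalPartial 1 (bubble c x₁) x) := by
    intro x
    by_cases hxB : x ∈ B
    · simp [hzero x hxB, -Function.comp_apply]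
    · simp [ht.eq_zero hxB, (ht.classicalPartial _).eq_zero hxB]
  rw [hen]
  simp_rw [e]
  rw [integral_add hES hEB, ← henergy]
  have h1 := integral_energyDensity_shift_le κ Q hS hfg.memLp hfg.memLp_partial
  have h2 := hcE x₁
  linarith

end Admissible

end ConfinedSkyrmion

theorem proposition3p2 (Ω : Set ConfinedSkyrmion.Plane)
    (hΩ : ConfinedSkyrmion.IsBoundedLipschitzDomain Ω) (κ Q : ℝ) (d : ℕ) :
    ConfinedSkyrmion.infEnergy Ω κ Q ((d : ℤ) + 1) ≤
      ConfinedSkyrmion.infEnergy Ω κ Q (d : ℤ) + ((8 * Real.pi : ℝ) : EReal) := by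
  rw [← EReal.sub_le_iff_le_add (Or.inl (EReal.coe_ne_bot _)) (Or.inl (EReal.coe_ne_top _))]
  refine le_iInf₂ fun m hm => ?_
  rw [EReal.sub_le_iff_le_add (Or.inl (EReal.coe_ne_bot _)) (Or.inl (EReal.coe_ne_top _)),
    ← EReal.coe_add]
  refine EReal.le_of_forall_lt_iff_le.1 fun z hz => ?_
  have hz' : 0 < z - (ConfinedSkyrmion.energy Ω κ Q m + 8 * Real.pi) :=
    sub_pos.2 (EReal.coe_lt_coe_iff.1 hz)
  obtain ⟨m', hm', hle⟩ := ConfinedSkyrmion.exists_mem_admissible_add_one hΩ κ Q hm hz'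
  refine (iInf₂_le m' hm').trans (EReal.coe_le_coe_iff.2 ?_)
  linarith
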